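/- Let $\mathcal S$ be a measurable state space, let the action space be $\mathbb R^d$ with the Euclidean norm, let $P(ds'\mid s,a)$ be a Markov kernel from $\mathcal S\times\mathbb R^d$ to $\mathcal S$, let $r:\mathcal S\times\mathbb R^d\to\mathbb R$ be measurable with $|r(s,a)|\le R_{\max}$ for all $(s,a)$, and let $\gamma\in(0,1)$, $\beta>0$, $\tau>0$. A policy $\pi$ is given by a jointly measurable family of probability densities $\pi(\cdot\mid s)$ on $\mathbb R^d$. Its soft value function is $$V^\pi(s)=\mathbb E\Big[\sum_{n\ge 0}\gamma^n\big(r(s_n,a_n)-\tfrac{\beta}{2}\|a_n\|^2-\tau\log\pi(a_n\mid s_n)\big)\,\Big|\,s_0=s\Big],$$ where $a_n\sim\pi(\cdot\mid s_n)$ and $s_{n+1}\sim P(\cdot\mid s_n,a_n)$. Put $$Q^\pi(s,a)=r(s,a)-\tfrac{\beta}{2}\|a\|^2+\gamma\int_{\mathcal S}V^\pi(s')\,P(ds'\mid s,a),\qquad p_s^\pi(a)=\frac{\exp(Q^\pi(s,a)/\tau)}{\int_{\mathbb R^d}\exp(Q^\pi(s,\tilde a)/\tau)\,d\tilde a}.$$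 For probability measures $\mu\ll\nu$ on $\mathbb R^d$, where $\nu$ has a Lebesgue density bounded above and away from $0$ on compact sets, let $f=d\mu/d\nu$, $\mathrm{KL}(\mu\|\nu)=\int\log f\,d\mu$ and $\mathcal I(\mu\|\nu)=\int\|\nabla\log f\|^2\,d\mu\in[0,\infty]$, with $\nabla\log f=f^{-1}\nabla f$ for the weak gradient $\nabla f$ of $f$, and $\mathcal I(\mu\|\nu)=\infty$ if $f$ has no locally integrable weak gradient. **Lemma (Uniform LSI).** Let $\pi$ be a policy (for instance an iterate $\pi_k$ of Wasserstein policy gradient descent) for which $V^\pi(s)$ is well defined for every $s$ (the series converges almost surely and its sum is integrable), and suppose $|V^{\pi}(s)|\le V_{\max}$ for all $s\in\mathcal S$. Then, for every $s\in\mathcal S$, $p_s^{\pi}$ is a well-defined, everywhere positive probability density, and it satisfies the log-Sobolev inequality $$\mathcal I(\mu\|p_s^{\pi})\ \ge\ 2\,\alpha(V_{\max})\,\mathrm{KL}(\mu\|p_s^{\pi})\qquad\text{for every probability measure }\mu\ll p_s^{\pi},$$ with the constant $$\alpha(V_{\max})=\frac{\beta}{\tau}\exp\!\Big(-\frac{2(R_{\max}+\gamma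 V_{\max})}{\tau}\Big)>0,$$ which does not depend on $\pi$, $s$, $\mu$ or $d$. -/

import Mathlib

open MeasureTheory ProbabilityTheory InformationTheory
open scoped ENNReal

/-- The action space `ℝ^d` with its Euclidean norm. -/
abbrev ActionSpace (d : ℕ) : Type := EuclideanSpace ℝ (Fin d)

/-- An entropy-regularized discounted Markov decision process with state space `S` and action
space `ℝ^d`: transition kernel `P(ds' ∣ s, a)`, reward `r`, discount factor `γ ∈ (0,1)`,
quadratic action penalty `β > 0` and temperature `τ > 0`. -/
structure SoftMDP (S : Type*) [MeasurableSpace S] (d : ℕ) where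
  P : Kernel (S × ActionSpace d) S
  isMarkovKernel_P : IsMarkovKernel P
  r : S → ActionSpace d → ℝ
  measurable_r : Measurable (Function.uncurry r)
  γ : ℝ
  γ_pos : 0 < γ
  γ_lt_one : γ < 1
  β : ℝ
  β_pos : 0 < β
  τ : ℝ
  τ_pos : 0 < τ

/-- A stationary Markov policy with a jointly measurable density `π(a ∣ s)` with respect to
Lebesgue measure on the action space. -/
structure Policy (S : Type*) [MeasurableSpace S] (d : ℕ) where
  dens : S → ActionSpace d → ℝ
  measurable_dens : Measurable (Function.uncurry dens)
  dens_nonneg : ∀ s a, 0 ≤ dens s a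
  lintegral_dens : ∀ s, ∫⁻ a, ENNReal.ofReal (dens s a) = 1

namespace Policy

variable {S : Type*} [MeasurableSpace S] {d : ℕ}

/-- The Markov kernel `π(da ∣ s) = π(a ∣ s) da`. -/
noncomputable def kernel (π : Policy S d) : Kernel S (ActionSpace d) :=
  Kernel.withDensity (Kernel.const S (volume : Measure (ActionSpace d)))
    (fun s a => ENNReal.ofReal (π.dens s a))

lemma kernel_apply (π : Policy S d) (s : S) :
    π.kernel s = volume.withDensity (fun a => ENNReal.ofReal (π.dens s a)) := by
  have h : Measurable (Function.uncurry fun s a => ENNReal.ofReal (π.dens s a)) :=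
    π.measurable_dens.ennreal_ofReal
  rw [kernel, Kernel.withDensity_apply _ h, Kernel.const_apply]

instance isMarkovKernel_kernel (π : Policy S d) : IsMarkovKernel π.kernel :=
  ⟨fun s => ⟨by
    rw [kernel_apply, withDensity_apply _ MeasurableSet.univ, Measure.restrict_univ]
    exact π.lintegral_dens s⟩⟩

end Policy

namespace SoftMDP

variable {S : Type*} [MeasurableSpace S] {d : ℕ}

instance (M : SoftMDP S d) : IsMarkovKernel M.P := M.isMarkovKernel_P

/-- The regularized reward `r(s, a) - (β / 2) ‖a‖²`. -/
noncomputable def regReward (M : SoftMDP S d) (s : S) (a : ActionSpace d) : ℝ :=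
  M.r s a - M.β / 2 * ‖a‖ ^ 2

/-- One transition `(s, a) ↦ (s', a')` of the state-action chain under `π`:
`s' ∼ P(· ∣ s, a)`, then `a' ∼ π(· ∣ s')`. -/
noncomputable def stepKernel (M : SoftMDP S d) (π : Policy S d) :
    Kernel (S × ActionSpace d) (S × ActionSpace d) :=
  (Kernel.id ×ₖ π.kernel) ∘ₖ M.P

instance (M : SoftMDP S d) (π : Policy S d) : IsMarkovKernel (M.stepKernel π) := by
  unfold stepKernel; infer_instance

/-- The transition at time `n`, as a function of the whole history `(s₀, a₀), …, (sₙ, aₙ)`. -/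
noncomputable def historyKernel (M : SoftMDP S d) (π : Policy S d) (n : ℕ) :
    Kernel ((_ : Finset.Iic n) → S × ActionSpace d) (S × ActionSpace d) :=
  (M.stepKernel π).comap (fun h => h ⟨n, Finset.mem_Iic.2 le_rfl⟩) (measurable_pi_apply _)

instance (M : SoftMDP S d) (π : Policy S d) (n : ℕ) : IsMarkovKernel (M.historyKernel π n) := by
  unfold historyKernel; infer_instance

/-- `M.rollout π s` is the law of the trajectory `(sₙ, aₙ)_{n ≥ 0}` generated by `s₀ = s`,
`aₙ ∼ π(· ∣ sₙ)`, `sₙ₊₁ ∼ P(· ∣ sₙ, aₙ)`. -/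
noncomputable def rollout (M : SoftMDP S d) (π : Policy S d) :
    Kernel S (ℕ → S × ActionSpace d) :=
  Kernel.traj (X := fun _ => S × ActionSpace d) (M.historyKernel π) 0 ∘ₖ
    (Kernel.id ×ₖ π.kernel).map (fun z (_ : Finset.Iic 0) => z)

/-- The `n`-th summand `γⁿ (r̃(sₙ, aₙ) - τ log π(aₙ ∣ sₙ))` of the discounted soft return. -/
noncomputable def discountedReward (M : SoftMDP S d) (π : Policy S d)
    (ω : ℕ → S × ActionSpace d) (n : ℕ) : ℝ :=
  M.γ ^ n * (M.regReward (ω n).1 (ω n).2 - M.τ * Real.log (π.dens (ω n).1 (ω n).2))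

/-- The soft value function
`V^π(s) = 𝔼[∑ₙ γⁿ (r̃(sₙ, aₙ) - τ log π(aₙ ∣ sₙ)) ∣ s₀ = s]`. -/
noncomputable def softValue (M : SoftMDP S d) (π : Policy S d) (s : S) : ℝ :=
  ∫ ω, ∑' n, M.discountedReward π ω n ∂(M.rollout π s)

/-- The expectation that defines `V^π(s)` is well defined and finite for every state `s`. -/
def HasSoftValue (M : SoftMDP S d) (π : Policy S d) : Prop :=
  ∀ s, (∀ᵐ ω ∂(M.rollout π s), Summable (M.discountedReward π ω)) ∧
    Integrable (fun ω => ∑' n, M.discountedReward π ω n) (M.rollout π s)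

/-- The state-action value function `Q^π(s, a) = r̃(s, a) + γ ∫ V^π(s') P(ds' ∣ s, a)`. -/
noncomputable def softQ (M : SoftMDP S d) (π : Policy S d) (s : S) (a : ActionSpace d) : ℝ :=
  M.regReward s a + M.γ * ∫ s', M.softValue π s' ∂(M.P (s, a))

/-- The Gibbs density `p_s^π(a) = exp(Q^π(s, a) / τ) / ∫ exp(Q^π(s, ã) / τ) dã`. -/
noncomputable def gibbsDensity (M : SoftMDP S d) (π : Policy S d) (s : S)
    (a : ActionSpace d) : ℝ :=
  Real.exp (M.softQ π s a / M.τ) / ∫ b, Real.exp (M.softQ π s b / M.τ)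

/-- The measure on the action space with Lebesgue density `p_s^π`. -/
noncomputable def gibbsMeasure (M : SoftMDP S d) (π : Policy S d) (s : S) :
    Measure (ActionSpace d) :=
  volume.withDensity (fun a => ENNReal.ofReal (M.gibbsDensity π s a))

end SoftMDP

/-- `g` is a weak (distributional) gradient of `f` on `ℝ^d`. -/
def HasWeakGradient {d : ℕ} (f : ActionSpace d → ℝ) (g : ActionSpace d → ActionSpace d) : Prop :=
  LocallyIntegrable f ∧ LocallyIntegrable g ∧
    ∀ φ : ActionSpace d → ℝ, ContDiff ℝ ((⊤ : ℕ∞) : WithTop ℕ∞) φ → HasCompactSupport φ →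
      ∀ v : ActionSpace d, ∫ x, f x * fderiv ℝ φ x v = -∫ x, inner ℝ (g x) v * φ x

/-- The relative Fisher information `I(μ ‖ ν) = ∫ ‖∇ log (dμ/dν)‖² dμ ∈ [0, ∞]`, for `μ ≪ ν` and
`ν` with a density bounded above and away from `0` on compact sets.
Here `∇ log f = f⁻¹ ∇ f` for the weak gradient `∇ f` of `f = dμ/dν`, which is unique almost
everywhere if it exists. If it does not exist the infimum is over the empty set, so `I = ∞`. -/
noncomputable def relFisherInfo {d : ℕ} (μ ν : Measure (ActionSpace d)) : ℝ≥0∞ :=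
  ⨅ (g : ActionSpace d → ActionSpace d)
    (_ : HasWeakGradient (fun x => (μ.rnDeriv ν x).toReal) g),
    ∫⁻ x, ‖((μ.rnDeriv ν x).toReal)⁻¹ • g x‖ₑ ^ 2 ∂μ

/-- The log-Sobolev inequality with constant `α > 0`:
`I(μ ‖ ν) ≥ 2 α KL(μ ‖ ν)` for every probability measure `μ ≪ ν`. -/
def SatisfiesLSI {d : ℕ} (ν : Measure (ActionSpace d)) (α : ℝ) : Prop :=
  0 < α ∧ ∀ μ : Measure (ActionSpace d), IsProbabilityMeasure μ → μ ≪ ν →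
    ENNReal.ofReal (2 * α) * klDiv μ ν ≤ relFisherInfo μ ν

/-!
The Gibbs density at a state is `exp (Q / τ)` up to normalization, and `Q` is the quadratic penalty
`-(β / 2) ‖a‖²` plus a term bounded by `Rmax + γ Vmax`. With `v = τ / β` and
`C = (Rmax + γ Vmax) / τ`, the density therefore lies between `exp (-C)` and `exp C` times the
Gaussian weight `exp (-‖a‖² / (2v))`, up to one common factor. The Gaussian with covariance `v • 1`
satisfies a logarithmic Sobolev inequality with constant `1 / v` in every dimension, and a bounded
perturbation costs the factor `exp (-2C)` (`satisfiesLSI_of_le_of_le`).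

The perturbation step (Holley–Stroock) uses that the Bregman divergence
`entGap m f = f log f - f log m - f + m` is pointwise nonnegative, so that its integral is monotone in
the reference measure, while its integral bounds the relative entropy for every constant `m`
(`klDiv_le_lintegral_entGap`); `m` is taken to be the Gaussian mean of the density.

The Gaussian inequality is proved in two stages.

* For smooth densities (`gaussian_logSobolev_smooth`), interpolate between `f` and its mean by
  `P_θ f (x) = ∫ f (cos θ x + sin θ y) dG(y)`. Rotation invariance of `G × G` and integration by
  parts show that the entropy of `P_θ f` has derivative
  `-v sin θ cos θ ∫ ‖P_θ ∇f‖² / P_θ f dG`, whose absolute value is at most `v sin θ cos θ` times the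
  Fisher information of `f`. Integrating over `[0, π / 2]` gives the factor `v / 2`.

* For weakly differentiable densities (`gaussian_logSobolev`), cut off, mollify and add a small
  constant. Convexity of `(g, f) ↦ ‖g‖² / f` controls the Fisher information of the
  approximations, and Fatou's lemma handles the entropy. The Fisher information only sees the set
  where the density is positive, so this requires that a weak gradient vanishes almost everywhere
  on the zero set of a nonnegative function (`HasWeakGradient.ae_eq_zero`).
-/


/-! ### The isotropic Gaussian measure -/

section Gaussian

open Real

variable {E : Type*} [NormedAddCommGroup E]

/-- The unnormalized density `exp (-‖x‖² / (2v))` of the centred Gaussian with covariance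
`v • 1`. -/
noncomputable def gaussWeight (v : ℝ) (x : E) : ℝ := exp (-‖x‖ ^ 2 / (2 * v))

lemma gaussWeight_pos (v : ℝ) (x : E) : 0 < gaussWeight v x := exp_pos _

lemma continuous_gaussWeight (v : ℝ) : Continuous (gaussWeight v : E → ℝ) := by
  unfold gaussWeight; fun_prop

lemma gaussWeight_le_one {v : ℝ} (hv : 0 < v) (x : E) : gaussWeight v x ≤ 1 := by
  unfold gaussWeight
  rw [exp_le_one_iff, neg_div]
  have : 0 ≤ ‖x‖ ^ 2 / (2 * v) := by positivity
  linarith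

variable [InnerProductSpace ℝ E]

lemma hasFDerivAt_gaussWeight (v : ℝ) (x : E) :
    HasFDerivAt (gaussWeight v : E → ℝ) ((-(gaussWeight v x / v)) • innerSL ℝ x) x := by
  have h : HasFDerivAt (fun x : E => -‖x‖ ^ 2 / (2 * v)) ((-(1 / v)) • innerSL ℝ x) x := by
    have := ((hasStrictFDerivAt_norm_sq x).hasFDerivAt.neg).mul_const (2 * v)⁻¹
    refine this.congr_fderiv ?_
    ext y
    simp only [smul_apply, neg_apply, smul_eq_mul, mul_inv]
    simp only [nsmul_eq_mul, Nat.cast_ofNat]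
    ring
  refine h.exp.congr_fderiv ?_
  rw [smul_smul]
  congr 1
  unfold gaussWeight
  ring

/-- The rotation by the angle `θ` in the plane spanned by the two copies of `E` in `E × E`. -/
noncomputable def planeRotation (θ : ℝ) (z : E × E) : E × E :=
  (cos θ • z.1 + sin θ • z.2, -sin θ • z.1 + cos θ • z.2)

lemma norm_sq_planeRotation (θ : ℝ) (z : E × E) :
    ‖(planeRotation θ z).1‖ ^ 2 + ‖(planeRotation θ z).2‖ ^ 2 = ‖z.1‖ ^ 2 + ‖z.2‖ ^ 2 := by
  simp only [planeRotation, norm_add_sq_real, norm_smul, inner_smul_left, inner_smul_right,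
    mul_pow, norm_eq_abs, sq_abs, conj_trivial, abs_neg]
  have := sin_sq_add_cos_sq θ
  linear_combination (‖z.1‖ ^ 2 + ‖z.2‖ ^ 2) * this

variable [FiniteDimensional ℝ E] [MeasurableSpace E] [BorelSpace E]

lemma integrable_gaussWeight {v : ℝ} (hv : 0 < v) : Integrable (gaussWeight v : E → ℝ) := by
  have hb : 0 < ((1 / (2 * v) : ℝ) : ℂ).re := by rw [Complex.ofReal_re]; positivity
  have h := (GaussianFourier.integrable_cexp_neg_mul_sq_norm_add (V := E) hb 0 0).re
  refine h.congr (ae_of_all _ fun x => ?_)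
  have : (-((1 / (2 * v) : ℝ) : ℂ) * (‖x‖ : ℂ) ^ 2 + 0 * ((inner ℝ (0 : E) x : ℝ) : ℂ))
      = ((-‖x‖ ^ 2 / (2 * v) : ℝ) : ℂ) := by
    push_cast; ring
  simp only [gaussWeight]
  rw [this, ← Complex.ofReal_exp]
  rfl

lemma integrable_norm_mul_gaussWeight {v : ℝ} (hv : 0 < v) :
    Integrable (fun x : E => ‖x‖ * gaussWeight v x) := by
  have h := (integrable_gaussWeight (E := E) (v := 2 * v) (by positivity)).const_mul (1 + 4 * v)
  refine h.mono' (continuous_norm.mul (continuous_gaussWeight v)).aestronglyMeasurable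
    (ae_of_all _ fun x => ?_)
  have h1 : gaussWeight v x = gaussWeight (2 * v) x * exp (-(‖x‖ ^ 2 / (4 * v))) := by
    unfold gaussWeight
    rw [← exp_add]; congr 1; field_simp; ring
  rw [norm_of_nonneg (mul_nonneg (norm_nonneg _) (gaussWeight_pos _ _).le), h1]
  have h2 : ‖x‖ * exp (-(‖x‖ ^ 2 / (4 * v))) ≤ 1 + 4 * v := by
    rw [exp_neg, ← div_eq_mul_inv, div_le_iff₀ (exp_pos _)]
    have h3 := add_one_le_exp (‖x‖ ^ 2 / (4 * v))
    have h4 : (1 + 4 * v) * (‖x‖ ^ 2 / (4 * v) + 1) = ‖x‖ ^ 2 / (4 * v) + ‖x‖ ^ 2 + 1 + 4 * v := by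
      field_simp; ring
    have h5 : 0 ≤ ‖x‖ ^ 2 / (4 * v) := by positivity
    calc ‖x‖ ≤ (1 + 4 * v) * (‖x‖ ^ 2 / (4 * v) + 1) := by
          rw [h4]; nlinarith [sq_nonneg (‖x‖ - 1)]
      _ ≤ _ := by gcongr
  calc ‖x‖ * (gaussWeight (2 * v) x * exp (-(‖x‖ ^ 2 / (4 * v))))
      = (‖x‖ * exp (-(‖x‖ ^ 2 / (4 * v)))) * gaussWeight (2 * v) x := by ring
    _ ≤ _ := by gcongr; exact (gaussWeight_pos _ _).le

lemma integral_gaussWeight_pos {v : ℝ} (hv : 0 < v) : 0 < ∫ x : E, gaussWeight v x := by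
  rw [integral_pos_iff_support_of_nonneg (fun x => (gaussWeight_pos v x).le)
    (integrable_gaussWeight hv)]
  have : Function.support (gaussWeight v : E → ℝ) = Set.univ := by
    ext x; simp [(gaussWeight_pos v x).ne']
  rw [this]
  exact (Measure.measure_univ_pos.2 (NeZero.ne _))

/-- The density of the centred Gaussian with covariance `v • 1`. -/
noncomputable def gaussDensity (v : ℝ) (x : E) : ℝ := gaussWeight v x / ∫ y : E, gaussWeight v y

lemma gaussDensity_pos {v : ℝ} (hv : 0 < v) (x : E) : 0 < gaussDensity v x :=
  div_pos (gaussWeight_pos v x) (integral_gaussWeight_pos hv)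

lemma continuous_gaussDensity (v : ℝ) : Continuous (gaussDensity v : E → ℝ) :=
  (continuous_gaussWeight v).div_const _

lemma integrable_gaussDensity {v : ℝ} (hv : 0 < v) : Integrable (gaussDensity v : E → ℝ) :=
  (integrable_gaussWeight hv).div_const _

variable (E) in
/-- The centred Gaussian measure with covariance `v • 1` on a Euclidean space. -/
noncomputable def isoGaussian (v : ℝ) : Measure E :=
  volume.withDensity fun x => ENNReal.ofReal (gaussDensity v x)

lemma measurable_ofReal_gaussDensity (v : ℝ) :
    Measurable fun x : E => ENNReal.ofReal (gaussDensity v x) :=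
  (continuous_gaussDensity v).measurable.ennreal_ofReal

lemma isProbabilityMeasure_isoGaussian {v : ℝ} (hv : 0 < v) :
    IsProbabilityMeasure (isoGaussian E v) := by
  refine ⟨?_⟩
  rw [isoGaussian, withDensity_apply _ MeasurableSet.univ, Measure.restrict_univ,
    ← ofReal_integral_eq_lintegral_ofReal (integrable_gaussDensity hv)
      (ae_of_all _ fun x => (gaussDensity_pos hv x).le)]
  simp only [gaussDensity]
  rw [integral_div, div_self (integral_gaussWeight_pos hv).ne', ENNReal.ofReal_one]

lemma isoGaussian_absolutelyContinuous (v : ℝ) : isoGaussian E v ≪ volume :=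
  withDensity_absolutelyContinuous _ _

lemma integral_isoGaussian {v : ℝ} (hv : 0 < v) (f : E → ℝ) :
    ∫ x, f x ∂(isoGaussian E v) = ∫ x, gaussDensity v x * f x := by
  rw [isoGaussian, integral_withDensity_eq_integral_toReal_smul (measurable_ofReal_gaussDensity v)
    (ae_of_all _ fun x => ENNReal.ofReal_lt_top)]
  simp_rw [ENNReal.toReal_ofReal (gaussDensity_pos hv _).le, smul_eq_mul]

lemma integrable_isoGaussian_iff {v : ℝ} (hv : 0 < v) (f : E → ℝ) :
    Integrable f (isoGaussian E v) ↔ Integrable fun x => gaussDensity v x * f x := by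
  rw [isoGaussian, integrable_withDensity_iff_integrable_smul' (measurable_ofReal_gaussDensity v)
    (ae_of_all _ fun x => ENNReal.ofReal_lt_top)]
  simp_rw [ENNReal.toReal_ofReal (gaussDensity_pos hv _).le, smul_eq_mul]

lemma integrable_norm_isoGaussian {v : ℝ} (hv : 0 < v) :
    Integrable (fun x : E => ‖x‖) (isoGaussian E v) := by
  rw [integrable_isoGaussian_iff hv]
  refine ((integrable_norm_mul_gaussWeight hv).div_const (∫ y : E, gaussWeight v y)).congr
    (ae_of_all _ fun x => ?_)
  simp only [gaussDensity]; ring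

/-- Gaussian integration by parts. -/
lemma integral_mul_inner_isoGaussian {v : ℝ} (hv : 0 < v) {h : E → ℝ} {h' : E → E}
    (hh : ∀ x, HasFDerivAt h (innerSL ℝ (h' x)) x) (hc : Continuous h') {A B : ℝ}
    (hA : ∀ x, |h x| ≤ A) (hB : ∀ x, ‖h' x‖ ≤ B) (w : E) :
    ∫ x, h x * inner ℝ x w ∂(isoGaussian E v) = v * ∫ x, inner ℝ (h' x) w ∂(isoGaussian E v) := by
  have hhc : Continuous h := continuous_iff_continuousAt.2 fun x => (hh x).continuousAt
  have hd : ∀ x : E, HasFDerivAt (gaussDensity v : E → ℝ)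
      ((-(gaussDensity v x / v)) • innerSL ℝ x) x := fun x => by
    have := (hasFDerivAt_gaussWeight v x).mul_const (∫ y : E, gaussWeight v y)⁻¹
    refine this.congr_fderiv ?_
    rw [smul_smul]; congr 1; simp only [gaussDensity]; ring
  have hi1 : Integrable fun x : E => gaussDensity v x * inner ℝ (h' x) w := by
    refine ((integrable_gaussDensity hv).mul_const (B * ‖w‖)).mono'
      ((continuous_gaussDensity v).mul (hc.inner continuous_const)).aestronglyMeasurable
      (ae_of_all _ fun x => ?_)
    rw [norm_mul, norm_of_nonneg (gaussDensity_pos hv x).le]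
    refine mul_le_mul_of_nonneg_left ?_ (gaussDensity_pos hv x).le
    exact (norm_inner_le_norm _ _).trans (mul_le_mul_of_nonneg_right (hB x) (norm_nonneg _))
  have hi2 : Integrable fun x : E => gaussDensity v x * (h x * inner ℝ x w) := by
    refine ((integrable_isoGaussian_iff hv _).1
      ((integrable_norm_isoGaussian hv).const_mul (A * ‖w‖))).mono'
      ((continuous_gaussDensity v).mul
        (hhc.mul (continuous_id.inner continuous_const))).aestronglyMeasurable
      (ae_of_all _ fun x => ?_)
    rw [norm_mul, norm_of_nonneg (gaussDensity_pos hv x).le]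
    refine mul_le_mul_of_nonneg_left ?_ (gaussDensity_pos hv x).le
    rw [norm_mul]
    calc ‖h x‖ * ‖inner ℝ x w‖ ≤ A * (‖x‖ * ‖w‖) := by
          refine mul_le_mul (hA x) (norm_inner_le_norm _ _) (norm_nonneg _)
            ((abs_nonneg _).trans (hA x))
      _ = _ := by ring
  have hi3 : Integrable fun x : E => gaussDensity v x * h x := by
    refine ((integrable_gaussDensity hv).mul_const A).mono'
      ((continuous_gaussDensity v).mul hhc).aestronglyMeasurable
      (ae_of_all _ fun x => ?_)
    rw [norm_mul, norm_of_nonneg (gaussDensity_pos hv x).le]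
    exact mul_le_mul_of_nonneg_left (hA x) (gaussDensity_pos hv x).le
  have key := integral_bilinear_hasFDerivAt_right_eq_neg_left_of_integrable (μ := volume)
    (B := ContinuousLinearMap.mul ℝ ℝ) (f := gaussDensity v) (g := h) (v := w)
    (f' := fun x => (-(gaussDensity v x / v)) • innerSL ℝ x) (g' := fun x => innerSL ℝ (h' x))
    (by
      refine (hi2.const_mul (-(1 / v))).congr (ae_of_all _ fun x => ?_)
      simp only [ContinuousLinearMap.mul_apply', smul_apply,
        innerSL_apply_apply, smul_eq_mul]
      ring)
    (by simpa using hi1) (by simpa using hi3) (fun x _ => hd x) (fun x _ => hh x)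
  rw [integral_isoGaussian hv, integral_isoGaussian hv]
  simp only [ContinuousLinearMap.mul_apply', smul_apply,
        innerSL_apply_apply, smul_eq_mul] at key
  rw [key, ← integral_neg, ← integral_const_mul]
  refine integral_congr_ae (ae_of_all _ fun x => ?_)
  simp only
  field_simp

lemma measurePreserving_planeRotation_volume (θ : ℝ) :
    MeasurePreserving (planeRotation θ : E × E → E × E) volume volume := by
  let R : WithLp 2 (E × E) →ₗ[ℝ] WithLp 2 (E × E) :=
    { toFun := fun z => WithLp.toLp 2 (planeRotation θ (WithLp.ofLp z))
      map_add' := fun x y => by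
        refine WithLp.ofLp_injective 2 (Prod.ext ?_ ?_) <;> simp [planeRotation] <;> module
      map_smul' := fun a x => by
        refine WithLp.ofLp_injective 2 (Prod.ext ?_ ?_) <;> simp [planeRotation] <;> module }
  let RI : WithLp 2 (E × E) →ₗᵢ[ℝ] WithLp 2 (E × E) :=
    ⟨R, fun z => by
      rw [← sq_eq_sq₀ (norm_nonneg _) (norm_nonneg _), WithLp.prod_norm_sq_eq_of_L2,
        WithLp.prod_norm_sq_eq_of_L2]
      exact norm_sq_planeRotation θ (WithLp.ofLp z)⟩
  have h := (RI.toLinearIsometryEquiv rfl).measurePreserving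
  exact ((WithLp.volume_preserving_ofLp E E).comp h).comp (WithLp.volume_preserving_toLp E E)

/-- The product of two copies of an isotropic Gaussian is invariant under rotations mixing them. -/
lemma measurePreserving_planeRotation {v : ℝ} (hv : 0 < v) (θ : ℝ) :
    MeasurePreserving (planeRotation θ : E × E → E × E)
      ((isoGaussian E v).prod (isoGaussian E v)) ((isoGaussian E v).prod (isoGaussian E v)) := by
  have := isProbabilityMeasure_isoGaussian (E := E) hv
  have hm := measurePreserving_planeRotation_volume (E := E) θ
  refine ⟨hm.measurable, ?_⟩
  have hmeas : Measurable fun z : E × E =>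
      ENNReal.ofReal (gaussDensity v z.1) * ENNReal.ofReal (gaussDensity v z.2) :=
    ((measurable_ofReal_gaussDensity v).comp measurable_fst).mul
      ((measurable_ofReal_gaussDensity v).comp measurable_snd)
  have hprod : (isoGaussian E v).prod (isoGaussian E v) = (volume : Measure (E × E)).withDensity
      fun z => ENNReal.ofReal (gaussDensity v z.1) * ENNReal.ofReal (gaussDensity v z.2) := by
    have : SFinite (volume.withDensity fun x : E => ENNReal.ofReal (gaussDensity v x)) := by
      change SFinite (isoGaussian E v); infer_instance
    rw [isoGaussian, prod_withDensity (measurable_ofReal_gaussDensity v)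
      (measurable_ofReal_gaussDensity v)]
    rfl
  have hinv : ∀ z : E × E,
      ENNReal.ofReal (gaussDensity v (planeRotation θ z).1) *
        ENNReal.ofReal (gaussDensity v (planeRotation θ z).2) =
      ENNReal.ofReal (gaussDensity v z.1) * ENNReal.ofReal (gaussDensity v z.2) := fun z => by
    rw [← ENNReal.ofReal_mul (gaussDensity_pos hv _).le,
      ← ENNReal.ofReal_mul (gaussDensity_pos hv _).le]
    congr 1
    simp only [gaussDensity, gaussWeight]
    rw [div_mul_div_comm, div_mul_div_comm, ← exp_add, ← exp_add]
    congr 2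
    have := norm_sq_planeRotation θ z
    rw [← add_div, ← add_div, ← neg_add, ← neg_add, this]
  ext s hs
  rw [Measure.map_apply hm.measurable hs, hprod, withDensity_apply _ (hm.measurable hs),
    withDensity_apply _ hs, ← hm.setLIntegral_comp_preimage hs hmeas]
  simp_rw [hinv]

end Gaussian

/-! ### The Mehler semigroup and the Gaussian inequality for smooth densities -/

section Mehler

open Real

variable {E : Type*} [NormedAddCommGroup E] [InnerProductSpace ℝ E] {v : ℝ} {f : E → ℝ} {g : E → E}
  {ε K L : ℝ}

lemma abs_inner_rotated_le (hL : ∀ x, ‖g x‖ ≤ L) (θ : ℝ) (x y : E) :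
    ‖inner ℝ (g (cos θ • x + sin θ • y)) (-sin θ • x + cos θ • y)‖ ≤ L * (‖x‖ + ‖y‖) := by
  refine (norm_inner_le_norm _ _).trans ?_
  refine mul_le_mul (hL _) ((norm_add_le _ _).trans (add_le_add ?_ ?_)) (norm_nonneg _)
    ((norm_nonneg _).trans (hL 0))
  · rw [norm_smul, norm_eq_abs, abs_neg]
    exact mul_le_of_le_one_left (norm_nonneg _) (abs_sin_le_one θ)
  · rw [norm_smul, norm_eq_abs]
    exact mul_le_of_le_one_left (norm_nonneg _) (abs_cos_le_one θ)

variable [FiniteDimensional ℝ E] [MeasurableSpace E] [BorelSpace E]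
  {F : Type*} [NormedAddCommGroup F] [NormedSpace ℝ F]

/-- The Mehler average of `f` with angle `θ`. It is the Ornstein–Uhlenbeck semigroup at the time `t`
with `exp (-t) = cos θ`: it interpolates between `f` at `θ = 0` and the mean of `f` at
`θ = π / 2`. -/
noncomputable def mehler (v θ : ℝ) (f : E → F) (x : E) : F :=
  ∫ y, f (cos θ • x + sin θ • y) ∂(isoGaussian E v)

lemma integrable_comp_mehler [FiniteDimensional ℝ F] (hv : 0 < v) {h : E → F} (hh : Continuous h)
    (hL : ∀ x, ‖h x‖ ≤ L) (θ : ℝ) (x : E) :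
    Integrable (fun y => h (cos θ • x + sin θ • y)) (isoGaussian E v) := by
  have := isProbabilityMeasure_isoGaussian (E := E) hv
  refine Integrable.of_bound (C := L) ?_ (ae_of_all _ fun y => hL _)
  exact (hh.comp (by fun_prop)).aestronglyMeasurable

lemma continuous_mehler [FiniteDimensional ℝ F] (hv : 0 < v) {h : E → F} (hh : Continuous h)
    (hL : ∀ x, ‖h x‖ ≤ L) (θ : ℝ) : Continuous (mehler v θ h) := by
  have := isProbabilityMeasure_isoGaussian (E := E) hv
  refine continuous_of_dominated (bound := fun _ => L) (fun x => ?_)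
    (fun x => ae_of_all _ fun y => hL _) (integrable_const _) (ae_of_all _ fun y => ?_)
  · exact (hh.comp (by fun_prop)).aestronglyMeasurable
  · exact hh.comp (by fun_prop)

lemma norm_mehler_le (hv : 0 < v) {h : E → F} (hL : ∀ x, ‖h x‖ ≤ L) (θ : ℝ) (x : E) :
    ‖mehler v θ h x‖ ≤ L := by
  have := isProbabilityMeasure_isoGaussian (E := E) hv
  simpa [mehler] using norm_integral_le_of_norm_le_const (μ := isoGaussian E v)
    (ae_of_all _ fun y => hL (cos θ • x + sin θ • y))

lemma le_mehler (hv : 0 < v) (hc : Continuous f) (hε : ∀ x, ε ≤ f x)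
    (hK : ∀ x, ‖f x‖ ≤ K) (θ : ℝ) (x : E) : ε ≤ mehler v θ f x := by
  have := isProbabilityMeasure_isoGaussian (E := E) hv
  calc ε = ∫ _, ε ∂(isoGaussian E v) := by simp
    _ ≤ _ := integral_mono (integrable_const _) (integrable_comp_mehler hv hc hK θ x)
      fun y => hε _

/-- The Mehler average of a differentiable function is differentiable, and the gradient commutes
with averaging up to the factor `cos θ`. In the entropy production this factor is integrated against
`sin θ` over `[0, π / 2]`, which yields the constant `1 / 2`. -/
lemma hasFDerivAt_mehler (hv : 0 < v) (hf : ∀ x, HasFDerivAt f (innerSL ℝ (g x)) x)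
    (hg : Continuous g) (hK : ∀ x, ‖f x‖ ≤ K) (hL : ∀ x, ‖g x‖ ≤ L) (θ : ℝ) (x : E) :
    HasFDerivAt (mehler v θ f) (innerSL ℝ (cos θ • mehler v θ g x)) x := by
  have := isProbabilityMeasure_isoGaussian (E := E) hv
  have hc : Continuous f := continuous_iff_continuousAt.2 fun x => (hf x).continuousAt
  have hgc : Continuous fun y => innerSL ℝ (cos θ • g (cos θ • x + sin θ • y)) := by fun_prop
  have hbd : ∀ x y : E, ‖innerSL ℝ (cos θ • g (cos θ • x + sin θ • y))‖ ≤ L := fun x y => by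
    rw [innerSL_apply_norm, norm_smul]
    calc ‖cos θ‖ * ‖g (cos θ • x + sin θ • y)‖ ≤ 1 * L := by
          refine mul_le_mul ?_ (hL _) (norm_nonneg _) zero_le_one
          rw [norm_eq_abs]; exact abs_cos_le_one θ
      _ = L := one_mul L
  have h := hasFDerivAt_integral_of_dominated_of_fderiv_le (μ := isoGaussian E v) (x₀ := x)
    (F := fun x y => f (cos θ • x + sin θ • y))
    (F' := fun x y => innerSL ℝ (cos θ • g (cos θ • x + sin θ • y))) (bound := fun _ => L)
    Filter.univ_mem
    (Filter.Eventually.of_forall fun x => (hc.comp (by fun_prop)).aestronglyMeasurable)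
    (integrable_comp_mehler hv hc hK θ x) hgc.aestronglyMeasurable
    (ae_of_all _ fun y z _ => hbd z y) (integrable_const _)
    (ae_of_all _ fun y z _ => by
      have h1 : HasFDerivAt (fun x : E => cos θ • x + sin θ • y)
          (cos θ • ContinuousLinearMap.id ℝ E) z :=
        ((hasFDerivAt_id z).const_smul (cos θ)).add_const _
      refine ((hf _).comp z h1).congr_fderiv ?_
      ext w
      simp)
  refine h.congr_fderiv ?_
  ext w
  rw [ContinuousLinearMap.integral_apply (Integrable.of_bound (C := L) hgc.aestronglyMeasurable
    (ae_of_all _ fun y => hbd x y))]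
  simp only [innerSL_apply_apply, inner_smul_left, conj_trivial]
  rw [integral_const_mul, real_inner_comm, mehler,
    ← integral_inner (integrable_comp_mehler hv hg hL θ x)]
  simp_rw [real_inner_comm w]

/-- The derivative of the Mehler average in the angle, pointwise. -/
noncomputable def mehlerAngleDeriv (v θ : ℝ) (g : E → E) (x : E) : ℝ :=
  ∫ y, inner ℝ (g (cos θ • x + sin θ • y)) (-sin θ • x + cos θ • y) ∂(isoGaussian E v)

lemma integrable_angle_bound (hv : 0 < v) (x : E) :
    Integrable (fun y : E => L * (‖x‖ + ‖y‖)) (isoGaussian E v) := by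
  have := isProbabilityMeasure_isoGaussian (E := E) hv
  exact ((integrable_const _).add (integrable_norm_isoGaussian hv)).const_mul L

lemma hasDerivAt_mehler_angle (hv : 0 < v) (hf : ∀ x, HasFDerivAt f (innerSL ℝ (g x)) x)
    (hg : Continuous g) (hK : ∀ x, ‖f x‖ ≤ K) (hL : ∀ x, ‖g x‖ ≤ L) (θ : ℝ) (x : E) :
    HasDerivAt (fun θ => mehler v θ f x) (mehlerAngleDeriv v θ g x) θ := by
  have hc : Continuous f := continuous_iff_continuousAt.2 fun x => (hf x).continuousAt
  refine (hasDerivAt_integral_of_dominated_loc_of_deriv_le (μ := isoGaussian E v) (x₀ := θ)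
    (F := fun θ y => f (cos θ • x + sin θ • y))
    (F' := fun θ y => inner ℝ (g (cos θ • x + sin θ • y)) (-sin θ • x + cos θ • y))
    (bound := fun y => L * (‖x‖ + ‖y‖)) Filter.univ_mem
    (Filter.Eventually.of_forall fun θ => (hc.comp (by fun_prop)).aestronglyMeasurable)
    (integrable_comp_mehler hv hc hK θ x) ?_
    (ae_of_all _ fun y t _ => abs_inner_rotated_le hL t x y) (integrable_angle_bound hv x)
    (ae_of_all _ fun y t _ => ?_)).2
  · exact Continuous.aestronglyMeasurable (by fun_prop)
  · have h1 : HasDerivAt (fun θ : ℝ => cos θ • x + sin θ • y) (-sin t • x + cos t • y) t :=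
      ((hasDerivAt_cos t).smul_const x).add ((hasDerivAt_sin t).smul_const y)
    simpa [Function.comp_def] using (hf _).comp_hasDerivAt t h1

lemma continuous_mehlerAngleDeriv (hv : 0 < v) (hg : Continuous g) (hL : ∀ x, ‖g x‖ ≤ L) (θ : ℝ) :
    Continuous (mehlerAngleDeriv v θ g) := by
  refine continuous_iff_continuousAt.2 fun x => ?_
  refine continuousAt_of_dominated (bound := fun y => L * ((‖x‖ + 1) + ‖y‖))
    (Filter.Eventually.of_forall fun z => Continuous.aestronglyMeasurable (by fun_prop))
    ?_ ?_ (ae_of_all _ fun y => Continuous.continuousAt (by fun_prop))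
  · filter_upwards [Metric.ball_mem_nhds x one_pos] with z hz
    refine ae_of_all _ fun y => (abs_inner_rotated_le hL θ z y).trans ?_
    have hL0 : 0 ≤ L := (norm_nonneg _).trans (hL 0)
    have : ‖z‖ ≤ ‖x‖ + 1 := by
      have h1 : ‖z - x‖ < 1 := by simpa [dist_eq_norm] using hz
      have h2 := norm_add_le x (z - x)
      rw [add_sub_cancel] at h2
      linarith
    gcongr
  · have := isProbabilityMeasure_isoGaussian (E := E) hv
    exact ((integrable_const _).add (integrable_norm_isoGaussian hv)).const_mul L

lemma abs_mehlerAngleDeriv_le (hv : 0 < v) (hL : ∀ x, ‖g x‖ ≤ L) (θ : ℝ) (x : E) :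
    ‖mehlerAngleDeriv v θ g x‖ ≤ L * (‖x‖ + ∫ y, ‖y‖ ∂(isoGaussian E v)) := by
  have := isProbabilityMeasure_isoGaussian (E := E) hv
  refine (norm_integral_le_of_norm_le (integrable_angle_bound hv x)
    (ae_of_all _ fun y => abs_inner_rotated_le hL θ x y)).trans_eq ?_
  rw [integral_const_mul, integral_add (integrable_const _) (integrable_norm_isoGaussian hv)]
  simp

lemma abs_log_le_of_mem_Icc {t : ℝ} (hε : 0 < ε) (h1 : ε ≤ t) (h2 : t ≤ K) :
    |log t| ≤ |log ε| + |log K| := by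
  have h3 := log_le_log hε h1
  have h4 := log_le_log (hε.trans_le h1) h2
  rw [abs_le]
  constructor
  · linarith [neg_abs_le (log ε), abs_nonneg (log K)]
  · linarith [le_abs_self (log K), abs_nonneg (log ε)]

lemma hasDerivAt_integral_mehler_mul_log (hv : 0 < v)
    (hf : ∀ x, HasFDerivAt f (innerSL ℝ (g x)) x)
    (hg : Continuous g) (hε : 0 < ε) (hεf : ∀ x, ε ≤ f x) (hK : ∀ x, ‖f x‖ ≤ K)
    (hL : ∀ x, ‖g x‖ ≤ L) (θ : ℝ) :
    HasDerivAt (fun θ => ∫ x, mehler v θ f x * log (mehler v θ f x) ∂(isoGaussian E v))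
      (∫ x, (log (mehler v θ f x) + 1) * mehlerAngleDeriv v θ g x ∂(isoGaussian E v)) θ := by
  have := isProbabilityMeasure_isoGaussian (E := E) hv
  have hc : Continuous f := continuous_iff_continuousAt.2 fun x => (hf x).continuousAt
  have hP := fun t => continuous_mehler hv hc hK t
  have hPε := fun t x => le_mehler hv hc hεf hK t x
  have hPK : ∀ t x, mehler v t f x ≤ K :=
    fun t x => (le_abs_self _).trans (norm_mehler_le hv hK t x)
  have hPpos := fun t x => hε.trans_le (hPε t x)
  have hlog := fun t x => abs_log_le_of_mem_Icc hε (hPε t x) (hPK t x)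
  have hlogc : ∀ t, Continuous fun x => log (mehler v t f x) :=
    fun t => (hP t).log fun x => (hPpos t x).ne'
  have hL0 : 0 ≤ L := (norm_nonneg _).trans (hL 0)
  refine (hasDerivAt_integral_of_dominated_loc_of_deriv_le (μ := isoGaussian E v) (x₀ := θ)
    (F := fun θ x => mehler v θ f x * log (mehler v θ f x))
    (F' := fun θ x => (log (mehler v θ f x) + 1) * mehlerAngleDeriv v θ g x)
    (bound := fun x => (|log ε| + |log K| + 1) * (L * (‖x‖ + ∫ y, ‖y‖ ∂(isoGaussian E v))))
    Filter.univ_mem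
    (Filter.Eventually.of_forall fun t => ((hP t).mul (hlogc t)).aestronglyMeasurable)
    ?_ ?_ (ae_of_all _ fun x t _ => ?_) ?_
    (ae_of_all _ fun x t _ => ?_)).2
  · refine Integrable.of_bound (C := K * (|log ε| + |log K|))
      ((hP θ).mul (hlogc θ)).aestronglyMeasurable (ae_of_all _ fun x => ?_)
    rw [norm_mul]
    exact mul_le_mul (norm_mehler_le hv hK θ x) (hlog θ x) (norm_nonneg _)
      ((norm_nonneg _).trans (hK 0))
  · exact (((hlogc θ).add continuous_const).mul
      (continuous_mehlerAngleDeriv hv hg hL θ)).aestronglyMeasurable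
  · rw [norm_mul]
    refine mul_le_mul ?_ (abs_mehlerAngleDeriv_le hv hL t x) (norm_nonneg _) (by positivity)
    refine (norm_add_le _ _).trans ?_
    simpa using hlog t x
  · exact (((integrable_norm_isoGaussian hv).add (integrable_const _)).const_mul L).const_mul _
  · exact (hasDerivAt_mul_log (hPpos t x).ne').comp t
      (hasDerivAt_mehler_angle hv hf hg hK hL t x)

/-- The entropy production along the Mehler flow. The integrand is a function of the pair
`(x, y)`; in the rotated coordinates `(u, w)` the vector `-sin θ • x + cos θ • y` is `w`, so
that Gaussian integration by parts in `w` applies. -/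
lemma integral_log_mehler_mul_angleDeriv (hv : 0 < v)
    (hf : ∀ x, HasFDerivAt f (innerSL ℝ (g x)) x)
    (hg : Continuous g) (hε : 0 < ε) (hεf : ∀ x, ε ≤ f x) (hK : ∀ x, ‖f x‖ ≤ K)
    (hL : ∀ x, ‖g x‖ ≤ L) (θ : ℝ) :
    ∫ x, (log (mehler v θ f x) + 1) * mehlerAngleDeriv v θ g x ∂(isoGaussian E v) =
      -(sin θ * cos θ * v) * ∫ x, ‖mehler v θ g x‖ ^ 2 / mehler v θ f x ∂(isoGaussian E v) := by
  set G := isoGaussian E v with hG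
  have := isProbabilityMeasure_isoGaussian (E := E) hv
  rw [← hG] at this
  have hc : Continuous f := continuous_iff_continuousAt.2 fun x => (hf x).continuousAt
  have hP := continuous_mehler hv hc hK θ
  have hN := continuous_mehler hv hg hL θ
  have hPε := fun x => le_mehler hv hc hεf hK θ x
  have hPK : ∀ x, mehler v θ f x ≤ K := fun x => (le_abs_self _).trans (norm_mehler_le hv hK θ x)
  have hPpos := fun x => hε.trans_le (hPε x)
  have hlog := fun x => abs_log_le_of_mem_Icc hε (hPε x) (hPK x)
  have hlogc : Continuous fun x => log (mehler v θ f x) := hP.log fun x => (hPpos x).ne'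
  have hL0 : 0 ≤ L := (norm_nonneg _).trans (hL 0)
  have hmp := measurePreserving_planeRotation (E := E) hv θ
  rw [← hG] at hmp
  set Ψ₁ : E × E → ℝ := fun z =>
    (log (mehler v θ f (cos θ • z.1 - sin θ • z.2)) + 1) * inner ℝ (g z.1) z.2 with hΨ₁
  have hcΨ₁ : Continuous Ψ₁ := by
    refine ((hlogc.comp (f := fun z : E × E => cos θ • z.1 - sin θ • z.2)
      (by fun_prop)).add continuous_const).mul ?_
    exact (hg.comp continuous_fst).inner continuous_snd
  set Ψ₂ : E × E → ℝ := fun z =>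
    inner ℝ (mehler v θ g (cos θ • z.1 - sin θ • z.2)) (g z.1) /
      mehler v θ f (cos θ • z.1 - sin θ • z.2) with hΨ₂
  have hcΨ₂ : Continuous Ψ₂ := by
    refine Continuous.div ?_ (hP.comp (f := fun z : E × E => cos θ • z.1 - sin θ • z.2)
      (by fun_prop)) fun z => (hPpos _).ne'
    exact (hN.comp (f := fun z : E × E => cos θ • z.1 - sin θ • z.2) (by fun_prop)).inner
      (hg.comp continuous_fst)
  have hback : ∀ z : E × E, cos θ • (planeRotation θ z).1 - sin θ • (planeRotation θ z).2 = z.1 :=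
    fun z => by
      simp only [planeRotation]
      have h : cos θ • (cos θ • z.1 + sin θ • z.2) - sin θ • (-sin θ • z.1 + cos θ • z.2)
        = (sin θ ^ 2 + cos θ ^ 2) • z.1 := by module
      rw [h, sin_sq_add_cos_sq, one_smul]
  have hnorm : Integrable (fun z : E × E => ‖z.2‖) (G.prod G) := by
    simpa using (integrable_norm_isoGaussian (E := E) hv).comp_snd G
  have hbΨ₁ : Integrable Ψ₁ (G.prod G) := by
    refine (hnorm.const_mul ((|log ε| + |log K| + 1) * L)).mono' hcΨ₁.aestronglyMeasurable
      (ae_of_all _ fun z => ?_)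
    rw [hΨ₁, norm_mul, mul_assoc]
    refine mul_le_mul ?_ ?_ (norm_nonneg _) (by positivity)
    · refine (norm_add_le _ _).trans ?_
      simpa using hlog _
    · exact (norm_inner_le_norm _ _).trans (mul_le_mul_of_nonneg_right (hL _) (norm_nonneg _))
  have hbΨ₂ : Integrable Ψ₂ (G.prod G) := by
    refine Integrable.of_bound (C := L * L / ε) hcΨ₂.aestronglyMeasurable (ae_of_all _ fun z => ?_)
    rw [hΨ₂, norm_div, norm_eq_abs (mehler _ _ _ _), abs_of_pos (hPpos _)]
    refine div_le_div₀ (by positivity) ?_ hε (hPε _)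
    exact (norm_inner_le_norm _ _).trans
      (mul_le_mul (norm_mehler_le hv hL θ _) (hL _) (norm_nonneg _) hL0)
  have hi1 : Integrable (Ψ₁ ∘ planeRotation θ) (G.prod G) :=
    hmp.integrable_comp_of_integrable hbΨ₁
  have hi2 : Integrable (Ψ₂ ∘ planeRotation θ) (G.prod G) :=
    hmp.integrable_comp_of_integrable hbΨ₂
  have hrot : ∀ Ψ : E × E → ℝ, Continuous Ψ →
      ∫ z, Ψ (planeRotation θ z) ∂(G.prod G) = ∫ z, Ψ z ∂(G.prod G) := fun Ψ hΨ => by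
    rw [← integral_map hmp.measurable.aemeasurable hΨ.aestronglyMeasurable, hmp.map_eq]
  calc ∫ x, (log (mehler v θ f x) + 1) * mehlerAngleDeriv v θ g x ∂G
      = ∫ x, ∫ y, Ψ₁ (planeRotation θ (x, y)) ∂G ∂G := by
        refine integral_congr_ae (ae_of_all _ fun x => ?_)
        simp only [mehlerAngleDeriv]
        rw [← integral_const_mul]
        refine integral_congr_ae (ae_of_all _ fun y => ?_)
        simp only [hΨ₁]
        rw [hback (x, y)]
        rfl
    _ = ∫ z, Ψ₁ z ∂(G.prod G) := by
        rw [← integral_prod (f := fun z => Ψ₁ (planeRotation θ z)) hi1, hrot _ hcΨ₁]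
    _ = ∫ u, ∫ w, Ψ₁ (u, w) ∂G ∂G := integral_prod _ hbΨ₁
    _ = ∫ u, -(sin θ * cos θ * v) * ∫ w, Ψ₂ (u, w) ∂G ∂G := by
        refine integral_congr_ae (ae_of_all _ fun u => ?_)
        simp only
        set N : E → E := fun w => (-(sin θ * cos θ) *
          (mehler v θ f (cos θ • u - sin θ • w))⁻¹) • mehler v θ g (cos θ • u - sin θ • w) with hNd
        have hNc : Continuous N := by
          refine Continuous.smul (continuous_const.mul (Continuous.inv₀ ?_ fun w => (hPpos _).ne'))
            (hN.comp (by fun_prop))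
          exact hP.comp (by fun_prop)
        have hib := integral_mul_inner_isoGaussian hv (w := g u)
          (h := fun w => log (mehler v θ f (cos θ • u - sin θ • w)) + 1)
          (h' := N) (A := |log ε| + |log K| + 1) (B := ε⁻¹ * L) (fun w => ?_) hNc (fun w => ?_)
          (fun w => ?_)
        · rw [hΨ₁]
          simp only [real_inner_comm _ (g u)] at hib ⊢
          rw [hib, ← integral_const_mul, ← integral_const_mul]
          refine integral_congr_ae (ae_of_all _ fun w => ?_)
          simp only [hNd, hΨ₂, inner_smul_left, conj_trivial]
          rw [div_eq_mul_inv]; ring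
        · have h1 : HasFDerivAt (fun w : E => cos θ • u - sin θ • w)
              (-(sin θ • ContinuousLinearMap.id ℝ E)) w :=
            ((hasFDerivAt_id w).const_smul (sin θ)).const_sub _
          have h2 := (((hasFDerivAt_mehler hv hf hg hK hL θ _).comp w h1).log
            (hPpos _).ne').add_const 1
          refine h2.congr_fderiv ?_
          ext y
          simp only [hNd, Function.comp, innerSL_apply_apply, inner_smul_left, conj_trivial,
            smul_apply, ContinuousLinearMap.comp_apply, neg_apply, ContinuousLinearMap.id_apply,
            inner_neg_right, inner_smul_right, smul_eq_mul]
          ring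
        · refine (abs_add_le _ _).trans ?_
          simpa using hlog _
        · rw [hNd]
          simp only
          rw [norm_smul, norm_mul]
          refine mul_le_mul ?_ (norm_mehler_le hv hL θ _) (norm_nonneg _) (by positivity)
          calc ‖-(sin θ * cos θ)‖ * ‖(mehler v θ f (cos θ • u - sin θ • w))⁻¹‖ ≤ 1 * ε⁻¹ := by
                refine mul_le_mul ?_ ?_ (norm_nonneg _) zero_le_one
                · rw [norm_neg, norm_mul]
                  exact mul_le_one₀ (abs_sin_le_one θ) (norm_nonneg _) (abs_cos_le_one θ)
                · rw [norm_inv, norm_eq_abs, abs_of_pos (hPpos _)]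
                  exact inv_anti₀ hε (hPε _)
            _ = ε⁻¹ := one_mul _
    _ = -(sin θ * cos θ * v) * ∫ z, Ψ₂ z ∂(G.prod G) := by
        rw [integral_const_mul, integral_prod _ hbΨ₂]
    _ = -(sin θ * cos θ * v) * ∫ x, ∫ y, Ψ₂ (planeRotation θ (x, y)) ∂G ∂G := by
        rw [← integral_prod (f := fun z => Ψ₂ (planeRotation θ z)) hi2, hrot _ hcΨ₂]
    _ = _ := by
        congr 1
        refine integral_congr_ae (ae_of_all _ fun x => ?_)
        simp only [hΨ₂]
        simp_rw [hback (x, _)]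
        rw [integral_div]
        congr 1
        simp only [planeRotation]
        rw [integral_inner (integrable_comp_mehler hv hg hL θ x), ← real_inner_self_eq_norm_sq]
        rfl

/-- Averaging decreases the Fisher information, by convexity of `(N, P) ↦ ‖N‖² / P` and rotation
invariance. -/
lemma integral_norm_sq_mehler_div_le (hv : 0 < v) (hc : Continuous f)
    (hg : Continuous g) (hε : 0 < ε) (hεf : ∀ x, ε ≤ f x) (hK : ∀ x, ‖f x‖ ≤ K)
    (hL : ∀ x, ‖g x‖ ≤ L) (θ : ℝ) :
    ∫ x, ‖mehler v θ g x‖ ^ 2 / mehler v θ f x ∂(isoGaussian E v) ≤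
      ∫ x, ‖g x‖ ^ 2 / f x ∂(isoGaussian E v) := by
  set G := isoGaussian E v with hG
  have := isProbabilityMeasure_isoGaussian (E := E) hv
  rw [← hG] at this
  have hmp := measurePreserving_planeRotation (E := E) hv θ
  rw [← hG] at hmp
  have hPpos := fun x => hε.trans_le (le_mehler hv hc hεf hK θ x)
  have hfpos := fun x => hε.trans_le (hεf x)
  have hL0 : 0 ≤ L := (norm_nonneg _).trans (hL 0)
  have hqc : Continuous fun x => ‖g x‖ ^ 2 / f x :=
    (hg.norm.pow 2).div hc fun x => (hfpos x).ne'
  have hqb : ∀ x, ‖‖g x‖ ^ 2 / f x‖ ≤ L ^ 2 / ε := fun x => by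
    rw [norm_of_nonneg (div_nonneg (sq_nonneg _) (hfpos x).le)]
    exact div_le_div₀ (by positivity) (pow_le_pow_left₀ (norm_nonneg _) (hL x) 2) hε (hεf x)
  have hpt : ∀ x, ‖mehler v θ g x‖ ^ 2 / mehler v θ f x ≤
      mehler v θ (fun x => ‖g x‖ ^ 2 / f x) x := by
    intro x
    set k := (mehler v θ f x)⁻¹ • mehler v θ g x with hk
    have h1 : ‖mehler v θ g x‖ ^ 2 / mehler v θ f x =
        ∫ y, (2 * inner ℝ k (g (cos θ • x + sin θ • y)) -
          ‖k‖ ^ 2 * f (cos θ • x + sin θ • y)) ∂G := by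
      rw [integral_sub, integral_const_mul, integral_const_mul,
        integral_inner (integrable_comp_mehler hv hg hL θ x)]
      · change _ = 2 * inner ℝ k (mehler v θ g x) - ‖k‖ ^ 2 * mehler v θ f x
        rw [hk, inner_smul_left, real_inner_self_eq_norm_sq, norm_smul, norm_inv, norm_eq_abs,
          abs_of_pos (hPpos x), conj_trivial]
        have := (hPpos x).ne'
        field_simp
        ring
      · exact ((integrable_comp_mehler hv hg hL θ x).const_inner k).const_mul 2
      · exact (integrable_comp_mehler hv hc hK θ x).const_mul _
    rw [h1]
    refine integral_mono ?_ (integrable_comp_mehler hv hqc hqb θ x) fun y => ?_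
    · exact (((integrable_comp_mehler hv hg hL θ x).const_inner k).const_mul 2).sub
        ((integrable_comp_mehler hv hc hK θ x).const_mul _)
    · simp only
      set z := cos θ • x + sin θ • y
      rw [le_div_iff₀ (hfpos z)]
      have h2 := real_inner_le_norm k (g z)
      have h3 := hfpos z
      nlinarith [sq_nonneg (‖k‖ * f z - ‖g z‖)]
  have hi : Integrable (fun z : E × E => ‖g z.1‖ ^ 2 / f z.1) (G.prod G) :=
    Integrable.of_bound (C := L ^ 2 / ε) (hqc.comp continuous_fst).aestronglyMeasurable
      (ae_of_all _ fun z => hqb z.1)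
  calc ∫ x, ‖mehler v θ g x‖ ^ 2 / mehler v θ f x ∂G
      ≤ ∫ x, mehler v θ (fun x => ‖g x‖ ^ 2 / f x) x ∂G := by
        refine integral_mono_of_nonneg
          (ae_of_all _ fun x => div_nonneg (sq_nonneg _) (hPpos x).le) ?_ (ae_of_all _ hpt)
        exact Integrable.of_bound (C := L ^ 2 / ε)
          (continuous_mehler hv hqc hqb θ).aestronglyMeasurable
          (ae_of_all _ fun x => norm_mehler_le hv hqb θ x)
    _ = ∫ z, ‖g (planeRotation θ z).1‖ ^ 2 / f (planeRotation θ z).1 ∂(G.prod G) := by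
        rw [integral_prod]
        · rfl
        · exact hmp.integrable_comp_of_integrable hi
    _ = ∫ z, ‖g z.1‖ ^ 2 / f z.1 ∂(G.prod G) := by
        rw [← integral_map (f := fun z : E × E => ‖g z.1‖ ^ 2 / f z.1) hmp.measurable.aemeasurable
          (hqc.comp continuous_fst).aestronglyMeasurable, hmp.map_eq]
    _ = _ := by
        rw [integral_prod _ hi]
        simp

/-- The Gaussian log-Sobolev inequality for continuously differentiable densities bounded away from
zero and with bounded gradient. -/
theorem gaussian_logSobolev_smooth (hv : 0 < v) (hf : ∀ x, HasFDerivAt f (innerSL ℝ (g x)) x)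
    (hg : Continuous g) (hε : 0 < ε) (hεf : ∀ x, ε ≤ f x) (hK : ∀ x, ‖f x‖ ≤ K)
    (hL : ∀ x, ‖g x‖ ≤ L) :
    (∫ x, f x * log (f x) ∂(isoGaussian E v)) -
        (∫ x, f x ∂(isoGaussian E v)) * log (∫ x, f x ∂(isoGaussian E v)) ≤
      v / 2 * ∫ x, ‖g x‖ ^ 2 / f x ∂(isoGaussian E v) := by
  have := isProbabilityMeasure_isoGaussian (E := E) hv
  have hc : Continuous f := continuous_iff_continuousAt.2 fun x => (hf x).continuousAt
  set I := ∫ x, ‖g x‖ ^ 2 / f x ∂(isoGaussian E v) with hI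
  set H : ℝ → ℝ := fun θ =>
    (∫ x, mehler v θ f x * log (mehler v θ f x) ∂(isoGaussian E v)) + v * I / 2 * sin θ ^ 2 with hH
  have hd : ∀ θ, HasDerivAt H
      (-(sin θ * cos θ * v) * ∫ x, ‖mehler v θ g x‖ ^ 2 / mehler v θ f x ∂(isoGaussian E v)
        + v * I / 2 * (2 * sin θ * cos θ)) θ := fun θ => by
    have h1 := hasDerivAt_integral_mehler_mul_log hv hf hg hε hεf hK hL θ
    rw [integral_log_mehler_mul_angleDeriv hv hf hg hε hεf hK hL θ] at h1
    have h2 := ((hasDerivAt_sin θ).pow 2).const_mul (v * I / 2)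
    simpa [hH, Pi.add_def] using h1.add h2
  have hmono : MonotoneOn H (Set.Icc 0 (π / 2)) := by
    refine monotoneOn_of_deriv_nonneg (convex_Icc _ _)
      (fun θ _ => (hd θ).continuousAt.continuousWithinAt)
      (fun θ _ => (hd θ).differentiableAt.differentiableWithinAt) fun θ hθ => ?_
    rw [interior_Icc] at hθ
    rw [(hd θ).deriv]
    have hs : 0 ≤ sin θ := sin_nonneg_of_nonneg_of_le_pi hθ.1.le (by linarith [hθ.2, pi_pos])
    have hcos : 0 ≤ cos θ := cos_nonneg_of_neg_pi_div_two_le_of_le 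
      (by linarith [hθ.1, pi_pos]) hθ.2.le
    have hle := integral_norm_sq_mehler_div_le hv hc hg hε hεf hK hL θ
    have := mul_le_mul_of_nonneg_left hle (mul_nonneg (mul_nonneg hs hcos) hv.le)
    linarith
  have h := hmono (Set.left_mem_Icc.2 (by positivity)) (Set.right_mem_Icc.2 (by positivity))
    (by positivity)
  simp only [hH, mehler, cos_zero, sin_zero, cos_pi_div_two, sin_pi_div_two, one_smul, zero_smul,
    add_zero, zero_add, integral_const, probReal_univ, smul_eq_mul, one_mul, one_pow, mul_one,
    ne_eq, OfNat.ofNat_ne_zero, not_false_eq_true, zero_pow, mul_zero] at h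
  linarith

end Mehler

/-! ### Mollification of weakly differentiable functions -/

section Mollify

open Filter Topology ContinuousLinearMap

variable {d : ℕ} {F : Type*} [NormedAddCommGroup F] [NormedSpace ℝ F]

/-- A bump function on `ℝ^d` supported in the ball of radius `2 / (n + 1)`. -/
noncomputable def shrinkingBump (d n : ℕ) : ContDiffBump (0 : ActionSpace d) :=
  ⟨1 / (n + 1), 2 / (n + 1), by positivity, by gcongr; norm_num⟩

/-- The mollifier of scale `2 / (n + 1)`: a smooth probability density near the origin. -/
noncomputable def mollifier (d n : ℕ) : ActionSpace d → ℝ := (shrinkingBump d n).normed volume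

/-- The mollification of `u` at scale `2 / (n + 1)`. -/
noncomputable def mollify (n : ℕ) (u : ActionSpace d → F) : ActionSpace d → F :=
  convolution (mollifier d n) u (lsmul ℝ ℝ) volume

lemma mollifier_nonneg (n : ℕ) (x : ActionSpace d) : 0 ≤ mollifier d n x :=
  ContDiffBump.nonneg_normed _ x

lemma hasCompactSupport_mollifier (n : ℕ) : HasCompactSupport (mollifier d n) :=
  ContDiffBump.hasCompactSupport_normed _

lemma contDiff_mollifier (n : ℕ) {k : ℕ∞} : ContDiff ℝ k (mollifier d n) :=
  ContDiffBump.contDiff_normed _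

lemma mollify_apply (n : ℕ) (u : ActionSpace d → F) (x : ActionSpace d) :
    mollify n u x = ∫ y, mollifier d n (x - y) • u y :=
  convolution_lsmul_swap

lemma integrable_mollify_integrand (n : ℕ) {u : ActionSpace d → F} (hu : LocallyIntegrable u)
    (x : ActionSpace d) : Integrable fun y => mollifier d n (x - y) • u y := by
  have hc : HasCompactSupport fun y => mollifier d n (x - y) :=
    (hasCompactSupport_mollifier n).comp_homeomorph (Homeomorph.subLeft x)
  exact hu.integrable_smul_left_of_hasCompactSupport
    ((contDiff_mollifier (k := 0) n).continuous.comp (by fun_prop)) hc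

lemma continuous_mollify (n : ℕ) {u : ActionSpace d → F} (hu : LocallyIntegrable u) :
    Continuous (mollify n u) :=
  (hasCompactSupport_mollifier n).continuous_convolution_left _
    (contDiff_mollifier (k := 0) n).continuous hu

lemma tendsto_mollify_ae [CompleteSpace F] {u : ActionSpace d → F} (hu : LocallyIntegrable u) :
    ∀ᵐ x, Tendsto (fun n => mollify n u x) atTop (𝓝 (u x)) := by
  refine ContDiffBump.ae_convolution_tendsto_right_of_locallyIntegrable (K := 2)
    (φ := fun n => shrinkingBump d n) ?_ (Eventually.of_forall fun n => ?_) hu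
  · have h := (tendsto_one_div_add_atTop_nhds_zero_nat (𝕜 := ℝ)).const_mul 2
    simpa [shrinkingBump, div_eq_mul_inv] using h
  · simp only [shrinkingBump]
    exact le_of_eq (by ring)

lemma mollify_nonneg (n : ℕ) {u : ActionSpace d → ℝ} (hu : ∀ x, 0 ≤ u x) (x : ActionSpace d) :
    0 ≤ mollify n u x := by
  rw [mollify_apply]
  exact integral_nonneg fun y => mul_nonneg (mollifier_nonneg n _) (hu y)

lemma exists_norm_mollify_le (n : ℕ) {u : ActionSpace d → F} (hu : Integrable u) :
    ∃ C, ∀ x, ‖mollify n u x‖ ≤ C := by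
  obtain ⟨C, hC⟩ := (hasCompactSupport_mollifier (d := d) n).exists_bound_of_continuous
    (contDiff_mollifier (k := 0) n).continuous
  refine ⟨∫ y, C * ‖u y‖, fun x => ?_⟩
  rw [mollify_apply]
  refine norm_integral_le_of_norm_le (hu.norm.const_mul C) (ae_of_all _ fun y => ?_)
  rw [norm_smul]
  exact mul_le_mul_of_nonneg_right (hC _) (norm_nonneg _)

lemma integrable_mollify (n : ℕ) {u : ActionSpace d → F} (hu : Integrable u) :
    Integrable (mollify n u) :=
  Integrable.integrable_convolution _ (ContDiffBump.integrable_normed _) hu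

lemma integral_mollify (n : ℕ) {u : ActionSpace d → ℝ} (hu : Integrable u) :
    ∫ x, mollify n u x = ∫ x, u x := by
  have hi : Integrable (mollifier d n) := ContDiffBump.integrable_normed _
  have h1 : ∫ x, mollifier d n x = 1 := ContDiffBump.integral_normed _
  rw [mollify, integral_convolution _ hi hu, h1]
  simp

/-- For nonnegative functions, convergence almost everywhere and of the integrals implies
convergence in `L¹` (Scheffé's lemma); only the part that controls the negative part of the
difference, which is dominated by `u`, uses dominated convergence. -/
lemma tendsto_integral_abs_mollify_sub_of_nonneg {u : ActionSpace d → ℝ} (hu : Integrable u)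
    (h0 : ∀ x, 0 ≤ u x) :
    Tendsto (fun n => ∫ x, |mollify n u x - u x|) atTop (𝓝 0) := by
  have h1 : Tendsto (fun n => ∫ x, max (u x - mollify n u x) 0) atTop (𝓝 0) := by
    have := tendsto_integral_of_dominated_convergence (F := fun n x => max (u x - mollify n u x) 0)
      (f := fun _ => 0) (μ := volume) u (fun n => ?_) hu (fun n => ae_of_all _ fun x => ?_) ?_
    · simpa using this
    · exact ((hu.sub (integrable_mollify n hu)).pos_part).aestronglyMeasurable
    · rw [Real.norm_of_nonneg (le_max_right _ _)]
      exact max_le (by linarith [mollify_nonneg n h0 x]) (h0 x)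
    · filter_upwards [tendsto_mollify_ae hu.locallyIntegrable] with x hx
      have := ((tendsto_const_nhds (x := u x)).sub hx).max (tendsto_const_nhds (x := (0 : ℝ)))
      simpa using this
  have h2 : ∀ n, ∫ x, |mollify n u x - u x| = 2 * ∫ x, max (u x - mollify n u x) 0 := fun n => by
    have hi : Integrable fun x => max (u x - mollify n u x) 0 :=
      (hu.sub (integrable_mollify n hu)).pos_part
    have hs : Integrable fun x => u x - mollify n u x := hu.sub (integrable_mollify n hu)
    have h3 : ∫ x, (u x - mollify n u x) = 0 := by
      rw [integral_sub hu (integrable_mollify n hu), integral_mollify n hu, sub_self]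
    have h4 : ∀ x, |mollify n u x - u x| =
        2 * max (u x - mollify n u x) 0 - (u x - mollify n u x) := fun x => by
      rcases le_total 0 (u x - mollify n u x) with h | h
      · rw [max_eq_left h, abs_sub_comm, abs_of_nonneg h]; ring
      · rw [max_eq_right h, abs_sub_comm, abs_of_nonpos h]; ring
    simp_rw [h4]
    rw [integral_sub (hi.const_mul 2) hs, h3, integral_const_mul,
      sub_zero]
  simp_rw [h2]
  simpa using h1.const_mul 2

lemma mollify_sub (n : ℕ) {u w : ActionSpace d → F} (hu : LocallyIntegrable u)
    (hw : LocallyIntegrable w) (x : ActionSpace d) :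
    mollify n (fun y => u y - w y) x = mollify n u x - mollify n w x := by
  rw [mollify_apply, mollify_apply, mollify_apply, ← integral_sub
    (integrable_mollify_integrand n hu x) (integrable_mollify_integrand n hw x)]
  simp_rw [smul_sub]

/-- Mollifications of an integrable function converge in `L¹`. -/
lemma tendsto_integral_abs_mollify_sub {u : ActionSpace d → ℝ} (hu : Integrable u) :
    Tendsto (fun n => ∫ x, |mollify n u x - u x|) atTop (𝓝 0) := by
  have hp := hu.pos_part
  have hm := hu.neg_part
  have h := (tendsto_integral_abs_mollify_sub_of_nonneg hp fun x => le_max_right _ _).add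
    (tendsto_integral_abs_mollify_sub_of_nonneg hm fun x => le_max_right _ _)
  rw [add_zero] at h
  refine squeeze_zero (fun n => integral_nonneg fun x => abs_nonneg _) (fun n => ?_) h
  have hip : Integrable fun x => |mollify n (fun y => max (u y) 0) x - max (u x) 0| :=
    ((integrable_mollify n hp).sub hp).abs
  have him : Integrable fun x => |mollify n (fun y => max (-u y) 0) x - max (-u x) 0| :=
    ((integrable_mollify n hm).sub hm).abs
  rw [← integral_add hip him]
  refine integral_mono ((integrable_mollify n hu).sub hu).abs (hip.add him) fun x => ?_
  have hux : ∀ y, u y = max (u y) 0 - max (-u y) 0 := fun y => by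
    rcases le_total 0 (u y) with h | h
    · rw [max_eq_left h, max_eq_right (by linarith)]; ring
    · rw [max_eq_right h, max_eq_left (by linarith)]; ring
  have hmx : mollify n u x =
      mollify n (fun y => max (u y) 0) x - mollify n (fun y => max (-u y) 0) x := by
    rw [← mollify_sub n hp.locallyIntegrable hm.locallyIntegrable]
    congr 1
    exact funext hux
  simp only [hmx]
  calc _ = |(mollify n (fun y => max (u y) 0) x - max (u x) 0) -
        (mollify n (fun y => max (-u y) 0) x - max (-u x) 0)| := by
          congr 1; linear_combination -(hux x)
    _ ≤ _ := abs_sub _ _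

/-- Mollification turns a weak gradient into a classical one. -/
lemma HasWeakGradient.hasFDerivAt_mollify {f : ActionSpace d → ℝ}
    {g : ActionSpace d → ActionSpace d} (h : HasWeakGradient f g) (n : ℕ) (x : ActionSpace d) :
    HasFDerivAt (mollify n f) (innerSL ℝ (mollify n g x)) x := by
  obtain ⟨hf, hg, hfg⟩ := h
  have hcd := contDiff_mollifier (d := d) (k := ⊤) n
  have hcs := hasCompactSupport_mollifier (d := d) n
  refine (hcs.hasFDerivAt_convolution_left (lsmul ℝ ℝ) (hcd.of_le (by exact_mod_cast le_top))
    hf x).congr_fderiv ?_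
  have hdc : Continuous (fderiv ℝ (mollifier d n)) := hcd.continuous_fderiv (by simp)
  ext v
  have hex := (hcs.fderiv ℝ).convolutionExists_left
    ((lsmul ℝ ℝ : ℝ →L[ℝ] ℝ →L[ℝ] ℝ).precompL (ActionSpace d)) hdc hf (μ := volume) x
  have hφc : HasCompactSupport fun y => mollifier d n (x - y) :=
    hcs.comp_homeomorph (Homeomorph.subLeft x)
  have hφ : ContDiff ℝ ((⊤ : ℕ∞) : WithTop ℕ∞) fun y => mollifier d n (x - y) :=
    hcd.comp (contDiff_const.sub contDiff_id)
  have hdφ : ∀ y, fderiv ℝ (fun y => mollifier d n (x - y)) y v =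
      -fderiv ℝ (mollifier d n) (x - y) v := fun y => by
    have h1 : HasFDerivAt (fun y => mollifier d n (x - y))
        ((fderiv ℝ (mollifier d n) (x - y)).comp (-ContinuousLinearMap.id ℝ (ActionSpace d))) y :=
      ((hcd.differentiable (by simp) _).hasFDerivAt).comp y ((hasFDerivAt_id y).const_sub x)
    rw [h1.fderiv]
    simp
  have hkey := hfg _ hφ hφc v
  simp_rw [hdφ] at hkey
  rw [convolution_eq_swap, ContinuousLinearMap.integral_apply]
  · simp only [precompL_apply, lsmul_apply, innerSL_apply_apply, smul_eq_mul]
    rw [mollify_apply, real_inner_comm,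
      ← integral_inner (integrable_mollify_integrand n hg x)]
    simp only [mul_neg, integral_neg, neg_inj] at hkey
    simp only [inner_smul_right]
    calc _ = ∫ y, f y * fderiv ℝ (mollifier d n) (x - y) v := by simp_rw [mul_comm]
      _ = _ := by
        rw [hkey]
        refine integral_congr_ae (ae_of_all _ fun y => ?_)
        simp only
        rw [real_inner_comm, mul_comm]
  · have := hex.comp_sub_left x
    refine this.congr (ae_of_all _ fun y => ?_)
    simp

end Mollify

/-! ### Weak gradients: products, and vanishing on level sets -/

section WeakGradient

open Filter Topology

variable {d : ℕ}

lemma continuous_smul_locallyIntegrable {F : Type*} [NormedAddCommGroup F] [NormedSpace ℝ F]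
    {u : ActionSpace d → F} (hu : LocallyIntegrable u) {χ : ActionSpace d → ℝ}
    (hχ : Continuous χ) : LocallyIntegrable fun x => χ x • u x := by
  rw [← locallyIntegrableOn_univ] at hu ⊢
  exact hu.continuousOn_smul isOpen_univ.isLocallyClosed hχ.continuousOn

lemma locallyIntegrable_smul_continuous {F : Type*} [NormedAddCommGroup F] [NormedSpace ℝ F]
    {u : ActionSpace d → ℝ} (hu : LocallyIntegrable u) {w : ActionSpace d → F}
    (hw : Continuous w) : LocallyIntegrable fun x => u x • w x := by
  rw [← locallyIntegrableOn_univ] at hu ⊢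
  exact hu.smul_continuousOn isOpen_univ.isLocallyClosed hw.continuousOn

lemma locallyIntegrable_inner_const {g : ActionSpace d → ActionSpace d} (hg : LocallyIntegrable g)
    (v : ActionSpace d) : LocallyIntegrable fun x => (inner ℝ (g x) v : ℝ) := fun x => by
  obtain ⟨s, hs, h⟩ := hg x
  exact ⟨s, hs, h.inner_const v⟩

lemma HasWeakGradient.congr_ae {f : ActionSpace d → ℝ} {g g' : ActionSpace d → ActionSpace d}
    (h : HasWeakGradient f g) (hgg : g =ᵐ[volume] g') : HasWeakGradient f g' := by
  obtain ⟨hf, hg, hfg⟩ := h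
  refine ⟨hf, hg.congr hgg, fun φ hφ hφc v => ?_⟩
  rw [hfg φ hφ hφc v]
  congr 1
  refine integral_congr_ae ?_
  filter_upwards [hgg] with x hx
  rw [hx]

/-- The Leibniz rule for the product of a smooth function and a weakly differentiable function. -/
lemma HasWeakGradient.smooth_mul {f : ActionSpace d → ℝ} {g : ActionSpace d → ActionSpace d}
    (h : HasWeakGradient f g) {χ : ActionSpace d → ℝ}
    (hχ : ContDiff ℝ ((⊤ : ℕ∞) : WithTop ℕ∞) χ) :
    HasWeakGradient (fun x => χ x * f x) (fun x => χ x • g x + f x • gradient χ x) := by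
  obtain ⟨hf, hg, hfg⟩ := h
  have hgc : Continuous (gradient χ) :=
    (InnerProductSpace.toDual ℝ (ActionSpace d)).symm.continuous.comp
      (hχ.continuous_fderiv (by simp))
  refine ⟨continuous_smul_locallyIntegrable hf hχ.continuous,
    (continuous_smul_locallyIntegrable hg hχ.continuous).add
      (locallyIntegrable_smul_continuous hf hgc), fun φ hφ hφc v => ?_⟩
  have hinner : ∀ x, inner ℝ (gradient χ x) v = fderiv ℝ χ x v := fun x =>
    InnerProductSpace.toDual_symm_apply
  have h1 := hfg (fun x => χ x * φ x) (hχ.mul hφ) hφc.mul_left v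
  have hd : ∀ x, fderiv ℝ (fun x => χ x * φ x) x v = χ x * fderiv ℝ φ x v + φ x * fderiv ℝ χ x v :=
    fun x => by
      rw [fderiv_fun_mul (hχ.differentiable (by simp) x) (hφ.differentiable (by simp) x)]
      simp
  have hdφ : Continuous fun x => fderiv ℝ φ x v :=
    (hφ.continuous_fderiv (by simp)).clm_apply continuous_const
  have hdφc : HasCompactSupport fun x => fderiv ℝ φ x v :=
    (hφc.fderiv ℝ).comp_left (g := fun L : ActionSpace d →L[ℝ] ℝ => L v) rfl
  have hdχ : Continuous fun x => fderiv ℝ χ x v :=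
    (hχ.continuous_fderiv (by simp)).clm_apply continuous_const
  have i1 : Integrable fun x => f x * (χ x * fderiv ℝ φ x v) :=
    hf.integrable_smul_right_of_hasCompactSupport (hχ.continuous.mul hdφ) hdφc.mul_left
  have i2 : Integrable fun x => f x * (φ x * fderiv ℝ χ x v) :=
    hf.integrable_smul_right_of_hasCompactSupport (hφ.continuous.mul hdχ) hφc.mul_right
  have i3 : Integrable fun x => inner ℝ (g x) v * (χ x * φ x) :=
    (locallyIntegrable_inner_const hg v).integrable_smul_right_of_hasCompactSupport
      (hχ.continuous.mul hφ.continuous) hφc.mul_left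
  simp_rw [hd, mul_add] at h1
  rw [integral_add i1 i2] at h1
  calc ∫ x, χ x * f x * fderiv ℝ φ x v = ∫ x, f x * (χ x * fderiv ℝ φ x v) := by
        congr 1; ext x; ring
    _ = -((∫ x, inner ℝ (g x) v * (χ x * φ x)) + ∫ x, f x * (φ x * fderiv ℝ χ x v)) := by
        linarith
    _ = _ := by
        rw [← integral_add i3 i2]
        congr 2; ext x
        rw [inner_add_left, inner_smul_left, inner_smul_left, hinner]
        simp only [conj_trivial]
        ring

/-- If `B n` is uniformly bounded and converges almost everywhere, and `u` is integrable, then `B n`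
may be paired with the mollifications of `u` in the limit. -/
lemma tendsto_integral_mul_mollify {u : ActionSpace d → ℝ} (hu : Integrable u)
    {B : ℕ → ActionSpace d → ℝ} {b : ActionSpace d → ℝ} (hB : ∀ n, AEStronglyMeasurable (B n))
    {C : ℝ} (hC : ∀ n x, ‖B n x‖ ≤ C) (hlim : ∀ᵐ x, Tendsto (fun n => B n x) atTop (𝓝 (b x))) :
    Tendsto (fun n => ∫ x, B n x * mollify n u x) atTop (𝓝 (∫ x, b x * u x)) := by
  have h1 : Tendsto (fun n => ∫ x, B n x * u x) atTop (𝓝 (∫ x, b x * u x)) := by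
    refine tendsto_integral_of_dominated_convergence (fun x => C * ‖u x‖)
      (fun n => (hB n).mul hu.aestronglyMeasurable) (hu.norm.const_mul C)
      (fun n => ae_of_all _ fun x => ?_) ?_
    · rw [norm_mul]
      exact mul_le_mul_of_nonneg_right (hC n x) (norm_nonneg _)
    · filter_upwards [hlim] with x hx using hx.mul_const _
  have h2 : Tendsto (fun n => ∫ x, B n x * (mollify n u x - u x)) atTop (𝓝 0) := by
    have h3 := (tendsto_integral_abs_mollify_sub hu).const_mul C
    rw [mul_zero] at h3
    refine squeeze_zero_norm (fun n => ?_) h3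
    rw [← integral_const_mul]
    refine norm_integral_le_of_norm_le (((integrable_mollify n hu).sub hu).abs.const_mul C)
      (ae_of_all _ fun x => ?_)
    rw [norm_mul]
    exact mul_le_mul_of_nonneg_right (hC n x) (abs_nonneg _)
  have h3 := h2.add h1
  rw [zero_add] at h3
  refine h3.congr fun n => ?_
  rw [← integral_add]
  · congr 1; ext x; ring
  · exact ((integrable_mollify n hu).sub hu).bdd_mul (hB n) (ae_of_all _ (hC n))
  · exact hu.bdd_mul (hB n) (ae_of_all _ (hC n))

/-- The chain rule for the bounded truncation `t ↦ ε t / (ε + t)` of a nonnegative weakly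
differentiable function, obtained from the classical rule by mollification. -/
lemma HasWeakGradient.integral_truncation {f : ActionSpace d → ℝ}
    {g : ActionSpace d → ActionSpace d} (h : HasWeakGradient f g) (hf0 : ∀ x, 0 ≤ f x)
    (hg : Integrable g) {ε : ℝ} (hε : 0 < ε) {φ : ActionSpace d → ℝ}
    (hφ : ContDiff ℝ ((⊤ : ℕ∞) : WithTop ℕ∞) φ) (hφc : HasCompactSupport φ) (v : ActionSpace d) :
    ∫ x, ε * f x / (ε + f x) * fderiv ℝ φ x v =
      -∫ x, ε ^ 2 / (ε + f x) ^ 2 * φ x * inner ℝ (g x) v := by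
  have hm0 := fun n x => mollify_nonneg n hf0 x
  have hpos : ∀ n x, 0 < ε + mollify n f x := fun n x => by linarith [hm0 n x]
  have hmc := fun n => continuous_mollify n h.1
  have hgc := fun n => continuous_mollify n h.2.1
  have hdφ : Continuous fun x => fderiv ℝ φ x v :=
    (hφ.continuous_fderiv (by simp)).clm_apply continuous_const
  have hdφc : HasCompactSupport fun x => fderiv ℝ φ x v :=
    (hφc.fderiv ℝ).comp_left (g := fun L : ActionSpace d →L[ℝ] ℝ => L v) rfl
  have hdφi := hdφ.integrable_of_hasCompactSupport hdφc (μ := volume)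
  have hu : Integrable fun x => (inner ℝ (g x) v : ℝ) := hg.inner_const v
  have hum : ∀ n x, mollify n (fun x => (inner ℝ (g x) v : ℝ)) x = inner ℝ (mollify n g x) v := by
    intro n x
    rw [mollify_apply, mollify_apply, real_inner_comm,
      ← integral_inner (integrable_mollify_integrand n h.2.1 x)]
    congr 1; ext y
    rw [inner_smul_right, real_inner_comm, smul_eq_mul]
  -- the identity for the mollified functions
  have hsmooth : ∀ n, ∫ x, ε * mollify n f x / (ε + mollify n f x) * fderiv ℝ φ x v =
      -∫ x, ε ^ 2 / (ε + mollify n f x) ^ 2 * φ x *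
        mollify n (fun x => (inner ℝ (g x) v : ℝ)) x := by
    intro n
    have hψc : Continuous fun x => ε * mollify n f x / (ε + mollify n f x) :=
      (continuous_const.mul (hmc n)).div (continuous_const.add (hmc n)) fun x => (hpos n x).ne'
    have hbc : Continuous fun x => ε ^ 2 / (ε + mollify n f x) ^ 2 :=
      continuous_const.div ((continuous_const.add (hmc n)).pow 2)
        fun x => pow_ne_zero 2 (hpos n x).ne'
    have hdc : Continuous fun x => (inner ℝ (mollify n g x) v : ℝ) := (hgc n).inner continuous_const
    have key := integral_bilinear_hasFDerivAt_right_eq_neg_left_of_integrable (μ := volume)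
      (B := ContinuousLinearMap.mul ℝ ℝ) (f := fun x => ε * mollify n f x / (ε + mollify n f x))
      (g := φ) (v := v)
      (f' := fun x => (ε ^ 2 / (ε + mollify n f x) ^ 2) • innerSL ℝ (mollify n g x))
      (g' := fderiv ℝ φ) ?_ ?_ ?_ ?_ ?_
    · simp only [ContinuousLinearMap.mul_apply', smul_apply, innerSL_apply_apply,
        smul_eq_mul] at key
      rw [key]
      congr 2; ext x
      rw [hum]; ring
    · simp only [ContinuousLinearMap.mul_apply', smul_apply, innerSL_apply_apply, smul_eq_mul]
      exact ((hbc.mul hdc).mul hφ.continuous).integrable_of_hasCompactSupport hφc.mul_left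
    · simp only [ContinuousLinearMap.mul_apply']
      exact (hψc.mul hdφ).integrable_of_hasCompactSupport hdφc.mul_left
    · simp only [ContinuousLinearMap.mul_apply']
      exact (hψc.mul hφ.continuous).integrable_of_hasCompactSupport hφc.mul_left
    · intro x _
      have h1 := h.hasFDerivAt_mollify n x
      have h2 : HasDerivAt (fun t => ε * t / (ε + t)) (ε ^ 2 / (ε + mollify n f x) ^ 2)
          (mollify n f x) := by
        have h3 := (((hasDerivAt_id (mollify n f x)).const_mul ε).div
          ((hasDerivAt_id (mollify n f x)).const_add ε) (hpos n x).ne')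
        refine h3.congr_deriv ?_
        simp only [id]
        congr 1; ring
      exact h2.comp_hasFDerivAt x h1
    · exact fun x _ => (hφ.differentiable (by simp) x).hasFDerivAt
  obtain ⟨Cφ, hCφ⟩ := hφc.exists_bound_of_continuous hφ.continuous
  have hae := tendsto_mollify_ae h.1
  have hL : Tendsto (fun n => ∫ x, ε * mollify n f x / (ε + mollify n f x) * fderiv ℝ φ x v) atTop
      (𝓝 (∫ x, ε * f x / (ε + f x) * fderiv ℝ φ x v)) := by
    refine tendsto_integral_of_dominated_convergence (fun x => ε * ‖fderiv ℝ φ x v‖)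
      (fun n => ?_) (hdφi.norm.const_mul ε) (fun n => ae_of_all _ fun x => ?_) ?_
    · exact (((continuous_const.mul (hmc n)).div (continuous_const.add (hmc n))
        fun x => (hpos n x).ne').mul hdφ).aestronglyMeasurable
    · rw [norm_mul]
      refine mul_le_mul_of_nonneg_right ?_ (norm_nonneg _)
      rw [Real.norm_of_nonneg (div_nonneg (mul_nonneg hε.le (hm0 n x)) (hpos n x).le),
        div_le_iff₀ (hpos n x)]
      nlinarith [hm0 n x]
    · filter_upwards [hae] with x hx
      exact ((hx.const_mul ε).div (hx.const_add ε) (by linarith [hf0 x])).mul_const _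
  have hR := tendsto_integral_mul_mollify hu (B := fun n x => ε ^ 2 / (ε + mollify n f x) ^ 2 * φ x)
    (b := fun x => ε ^ 2 / (ε + f x) ^ 2 * φ x) (C := Cφ)
    (fun n => ((continuous_const.div ((continuous_const.add (hmc n)).pow 2)
        fun x => pow_ne_zero 2 (hpos n x).ne').mul hφ.continuous).aestronglyMeasurable)
    (fun n x => by
      rw [norm_mul]
      refine (mul_le_of_le_one_left (norm_nonneg _) ?_).trans (hCφ x)
      rw [Real.norm_of_nonneg (by positivity), div_le_one (pow_pos (hpos n x) 2)]
      exact pow_le_pow_left₀ hε.le (by linarith [hm0 n x]) 2)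
    (by
      filter_upwards [hae] with x hx
      refine (tendsto_const_nhds.div ((hx.const_add ε).pow 2) ?_).mul_const _
      exact pow_ne_zero 2 (by linarith [hf0 x]))
  exact tendsto_nhds_unique hL (by simpa only [hsmooth] using hR.neg)

/-- The weak gradient of a nonnegative integrable function vanishes almost everywhere on its zero
set: in the truncation identity let `ε` tend to zero. -/
lemma HasWeakGradient.ae_eq_zero_of_integrable {f : ActionSpace d → ℝ}
    {g : ActionSpace d → ActionSpace d} (h : HasWeakGradient f g) (hf0 : ∀ x, 0 ≤ f x)
    (hg : Integrable g) : ∀ᵐ x, f x = 0 → g x = 0 := by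
  classical
  have hfm : AEMeasurable f := h.1.aestronglyMeasurable.aemeasurable
  have hb0 : ∀ t : ℝ, 0 ≤ t → Tendsto
      (fun n : ℕ => (1 / ((n : ℝ) + 1)) ^ 2 / (1 / ((n : ℝ) + 1) + t) ^ 2)
      atTop (𝓝 (if t = 0 then 1 else 0)) := fun t ht => by
    have hε := tendsto_one_div_add_atTop_nhds_zero_nat (𝕜 := ℝ)
    split_ifs with h0
    · refine tendsto_const_nhds.congr fun n => ?_
      rw [h0, add_zero, div_self (by positivity)]
    · have := (hε.pow 2).div ((hε.add_const t).pow 2) (by simpa using h0)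
      simpa [Pi.div_def] using this
  have hmeas : AEStronglyMeasurable (fun x => (if f x = 0 then 1 else 0 : ℝ)) volume := by
    have : Measurable fun t : ℝ => (if t = 0 then 1 else 0 : ℝ) :=
      Measurable.ite (measurableSet_singleton 0) measurable_const measurable_const
    exact (this.comp_aemeasurable hfm).aestronglyMeasurable
  have hint : Integrable fun x => (if f x = 0 then 1 else 0 : ℝ) • g x :=
    hg.bdd_smul 1 hmeas (ae_of_all _ fun x => by split_ifs <;> simp)
  have hzero : ∀ᵐ x, (if f x = 0 then 1 else 0 : ℝ) • g x = 0 := by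
    refine ae_eq_zero_of_integral_contDiff_smul_eq_zero hint.locallyIntegrable
      fun φ hφ hφc => ?_
    obtain ⟨Cφ, hCφ⟩ := hφc.exists_bound_of_continuous hφ.continuous
    have hφi : Integrable fun x => φ x • ((if f x = 0 then 1 else 0 : ℝ) • g x) :=
      hint.bdd_smul Cφ hφ.continuous.aestronglyMeasurable (ae_of_all _ hCφ)
    refine ext_inner_right ℝ fun v => ?_
    rw [inner_zero_left, real_inner_comm, ← integral_inner hφi]
    have hdφ : Continuous fun x => fderiv ℝ φ x v :=
      (hφ.continuous_fderiv (by simp)).clm_apply continuous_const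
    have hdφc : HasCompactSupport fun x => fderiv ℝ φ x v :=
      (hφc.fderiv ℝ).comp_left (g := fun L : ActionSpace d →L[ℝ] ℝ => L v) rfl
    have hdφi := hdφ.integrable_of_hasCompactSupport hdφc (μ := volume)
    have hposn : ∀ n : ℕ, 0 < 1 / ((n : ℝ) + 1) := fun n => by positivity
    have hL : Tendsto (fun n : ℕ => ∫ x, (1 / ((n : ℝ) + 1)) * f x / (1 / ((n : ℝ) + 1) + f x) *
        fderiv ℝ φ x v) atTop (𝓝 0) := by
      have h0 := (tendsto_one_div_add_atTop_nhds_zero_nat (𝕜 := ℝ)).mul_const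
        (∫ x, ‖fderiv ℝ φ x v‖)
      rw [zero_mul] at h0
      refine squeeze_zero_norm (fun n => ?_) h0
      rw [← integral_const_mul]
      refine norm_integral_le_of_norm_le (hdφi.norm.const_mul _) (ae_of_all _ fun x => ?_)
      rw [norm_mul]
      refine mul_le_mul_of_nonneg_right ?_ (norm_nonneg _)
      have hp := hposn n
      have hfx := hf0 x
      rw [Real.norm_of_nonneg (div_nonneg (mul_nonneg hp.le hfx) (by linarith)),
        div_le_iff₀ (by linarith)]
      nlinarith
    have hR : Tendsto (fun n : ℕ => ∫ x, (1 / ((n : ℝ) + 1)) ^ 2 / (1 / ((n : ℝ) + 1) + f x) ^ 2 *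
        φ x * inner ℝ (g x) v) atTop
        (𝓝 (∫ x, (if f x = 0 then 1 else 0) * φ x * inner ℝ (g x) v)) := by
      refine tendsto_integral_of_dominated_convergence (fun x => Cφ * ‖(inner ℝ (g x) v : ℝ)‖)
        (fun n => ?_) ((hg.inner_const v).norm.const_mul _) (fun n => ae_of_all _ fun x => ?_) ?_
      · exact ((aemeasurable_const.div ((hfm.const_add _).pow_const 2)).mul
          hφ.continuous.aemeasurable).aestronglyMeasurable.mul
            (hg.inner_const v).aestronglyMeasurable
      · rw [norm_mul, norm_mul]
        refine mul_le_mul_of_nonneg_right ?_ (norm_nonneg _)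
        refine (mul_le_of_le_one_left (norm_nonneg _) ?_).trans (hCφ x)
        have hp := hposn n
        have hfx := hf0 x
        rw [Real.norm_of_nonneg (by positivity), div_le_one (pow_pos (by linarith) 2)]
        exact pow_le_pow_left₀ hp.le (by linarith) 2
      · exact ae_of_all _ fun x => ((hb0 (f x) (hf0 x)).mul_const _).mul_const _
    have heq := tendsto_nhds_unique hL
      (by simpa only [h.integral_truncation hf0 hg (hposn _) hφ hφc v] using hR.neg)
    calc ∫ x, inner ℝ v (φ x • ((if f x = 0 then 1 else 0 : ℝ) • g x))
        = ∫ x, (if f x = 0 then 1 else 0) * φ x * inner ℝ (g x) v := by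
          congr 1; ext x
          rw [inner_smul_right, inner_smul_right, real_inner_comm]; ring
      _ = 0 := by linarith
  filter_upwards [hzero] with x hx h0
  simpa [h0] using hx

/-- The smooth cutoff that is `1` on the ball of radius `n + 1` and `0` outside the ball of radius
`2 (n + 1)`. -/
noncomputable def cutoff (d n : ℕ) (x : ActionSpace d) : ℝ :=
  (⟨1, 2, one_pos, one_lt_two⟩ : ContDiffBump (0 : ActionSpace d)) ((1 / ((n : ℝ) + 1)) • x)

lemma contDiff_cutoff (n : ℕ) : ContDiff ℝ ((⊤ : ℕ∞) : WithTop ℕ∞) (cutoff d n) :=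
  (ContDiffBump.contDiff _).comp (contDiff_const_smul _)

lemma cutoff_nonneg (n : ℕ) (x : ActionSpace d) : 0 ≤ cutoff d n x := ContDiffBump.nonneg _

lemma cutoff_le_one (n : ℕ) (x : ActionSpace d) : cutoff d n x ≤ 1 := ContDiffBump.le_one _

lemma hasCompactSupport_cutoff (n : ℕ) : HasCompactSupport (cutoff d n) := by
  have hn : (1 / ((n : ℝ) + 1)) ≠ 0 := by positivity
  exact (ContDiffBump.hasCompactSupport _).comp_homeomorph
    (Homeomorph.smulOfNeZero (1 / ((n : ℝ) + 1)) hn)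

lemma cutoff_eq_one {n : ℕ} {x : ActionSpace d} (hx : ‖x‖ ≤ n + 1) : cutoff d n x = 1 := by
  refine ContDiffBump.one_of_mem_closedBall _ ?_
  rw [mem_closedBall_zero_iff, norm_smul, Real.norm_of_nonneg (by positivity), one_div,
    inv_mul_le_iff₀ (by positivity)]
  simpa using hx

lemma tendsto_cutoff (x : ActionSpace d) : Tendsto (fun n => cutoff d n x) atTop (𝓝 1) := by
  obtain ⟨N, hN⟩ := exists_nat_ge ‖x‖
  refine tendsto_const_nhds.congr' ?_
  filter_upwards [eventually_ge_atTop N] with n hn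
  refine (cutoff_eq_one ?_).symm
  have : (N : ℝ) ≤ n := by exact_mod_cast hn
  linarith

lemma exists_norm_gradient_cutoff_le (d : ℕ) :
    ∃ C : ℝ, ∀ n x, ‖gradient (cutoff d n) x‖ ≤ C / ((n : ℝ) + 1) := by
  set b : ContDiffBump (0 : ActionSpace d) := ⟨1, 2, one_pos, one_lt_two⟩ with hb
  have hbd : ContDiff ℝ 1 b := b.contDiff
  obtain ⟨C, hC⟩ := (b.hasCompactSupport.fderiv ℝ).exists_bound_of_continuous
    (hbd.continuous_fderiv (by simp))
  refine ⟨C, fun n x => ?_⟩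
  have h1 : fderiv ℝ (cutoff d n) x = (1 / ((n : ℝ) + 1)) • fderiv ℝ b ((1 / ((n : ℝ) + 1)) • x) :=
    fderiv_comp_smul _
  rw [gradient, LinearIsometryEquiv.norm_map, h1, norm_smul, Real.norm_of_nonneg (by positivity),
    one_div, inv_mul_eq_div]
  gcongr
  exact hC _

/-- The weak gradient of a nonnegative function vanishes almost everywhere on its zero set. -/
lemma HasWeakGradient.ae_eq_zero {f : ActionSpace d → ℝ}
    {g : ActionSpace d → ActionSpace d} (h : HasWeakGradient f g) (hf0 : ∀ x, 0 ≤ f x) :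
    ∀ᵐ x, f x = 0 → g x = 0 := by
  have hn : ∀ n, ∀ᵐ x, cutoff d n x * f x = 0 →
      cutoff d n x • g x + f x • gradient (cutoff d n) x = 0 := fun n => by
    refine (h.smooth_mul (contDiff_cutoff n)).ae_eq_zero_of_integrable
      (fun x => mul_nonneg (cutoff_nonneg n x) (hf0 x)) ?_
    refine (h.2.1.integrable_smul_left_of_hasCompactSupport (contDiff_cutoff n).continuous
      (hasCompactSupport_cutoff n)).add ?_
    refine h.1.integrable_smul_right_of_hasCompactSupport ?_ ?_
    · exact (InnerProductSpace.toDual ℝ (ActionSpace d)).symm.continuous.comp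
        ((contDiff_cutoff n).continuous_fderiv (by simp))
    · exact ((hasCompactSupport_cutoff n).fderiv ℝ).comp_left (map_zero _)
  filter_upwards [ae_all_iff.2 hn] with x hx h0
  obtain ⟨N, hN⟩ := exists_nat_ge ‖x‖
  have := hx N (by rw [h0, mul_zero])
  rwa [cutoff_eq_one (by linarith), h0, zero_smul, add_zero, one_smul] at this

end WeakGradient

/-! ### The Gaussian logarithmic Sobolev inequality for weakly differentiable densities -/

section LogSobolev

open Filter Topology

variable {d : ℕ} {v : ℝ}

/-- The Bregman divergence of `t ↦ t log t` between `t` and `m`. Its integral is the entropy when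
`m` is the mean, and it is nonnegative pointwise. -/
noncomputable def entGap (m t : ℝ) : ℝ := t * Real.log t - t * Real.log m - t + m

lemma entGap_nonneg {m t : ℝ} (hm : 0 < m) (ht : 0 ≤ t) : 0 ≤ entGap m t := by
  unfold entGap
  rcases ht.eq_or_lt with rfl | ht
  · simpa using hm.le
  · have h := Real.one_sub_inv_le_log_of_pos (div_pos ht hm)
    rw [Real.log_div ht.ne' hm.ne', inv_div] at h
    have h2 := mul_le_mul_of_nonneg_left h ht.le
    have h3 : t * (1 - m / t) = t - m := by field_simp
    linarith

lemma measurable_entGap (m : ℝ) : Measurable (entGap m) := by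
  have := Real.continuous_mul_log.measurable
  unfold entGap
  fun_prop

/-- The lower semicontinuity of entropy under almost everywhere convergence. -/
lemma lintegral_entGap_le_of_tendsto {α : Type*} [MeasurableSpace α] {μ : Measure α}
    {f : α → ℝ} {F : ℕ → α → ℝ} (hF : ∀ n, AEMeasurable (F n) μ)
    (hlim : ∀ᵐ x ∂μ, Tendsto (fun n => F n x) atTop (𝓝 (f x))) {m : ℝ} {M : ℕ → ℝ}
    (hM : Tendsto M atTop (𝓝 m)) (hm : 0 < m) {c : ℝ} {C : ℕ → ℝ} (hC : Tendsto C atTop (𝓝 c))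
    (hle : ∀ᶠ n in atTop, ∫⁻ x, ENNReal.ofReal (entGap (M n) (F n x)) ∂μ ≤ ENNReal.ofReal (C n)) :
    ∫⁻ x, ENNReal.ofReal (entGap m (f x)) ∂μ ≤ ENNReal.ofReal c := by
  have hpt : ∀ᵐ x ∂μ, ENNReal.ofReal (entGap m (f x)) =
      liminf (fun n => ENNReal.ofReal (entGap (M n) (F n x))) atTop := by
    filter_upwards [hlim] with x hx
    refine (Tendsto.liminf_eq ?_).symm
    refine (ENNReal.continuous_ofReal.tendsto _).comp ?_
    have h1 := (Real.continuous_mul_log.tendsto (f x)).comp hx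
    exact ((h1.sub (hx.mul (hM.log hm.ne'))).sub hx).add hM
  rw [lintegral_congr_ae hpt]
  refine (lintegral_liminf_le'
    fun n => ((measurable_entGap _).comp_aemeasurable (hF n)).ennreal_ofReal).trans ?_
  refine (liminf_le_liminf hle).trans_eq ?_
  exact ((ENNReal.continuous_ofReal.tendsto _).comp hC).liminf_eq

lemma lintegral_entGap_le_of_smooth (hv : 0 < v) {f : ActionSpace d → ℝ}
    {g : ActionSpace d → ActionSpace d} {ε K L : ℝ}
    (hf : ∀ x, HasFDerivAt f (innerSL ℝ (g x)) x)
    (hg : Continuous g) (hε : 0 < ε) (hεf : ∀ x, ε ≤ f x) (hK : ∀ x, ‖f x‖ ≤ K)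
    (hL : ∀ x, ‖g x‖ ≤ L) :
    ∫⁻ x, ENNReal.ofReal (entGap (∫ y, f y ∂(isoGaussian (ActionSpace d) v)) (f x))
        ∂(isoGaussian (ActionSpace d) v) ≤
      ENNReal.ofReal (v / 2 * ∫ x, ‖g x‖ ^ 2 / f x ∂(isoGaussian (ActionSpace d) v)) := by
  have h := gaussian_logSobolev_smooth hv hf hg hε hεf hK hL
  have := isProbabilityMeasure_isoGaussian (E := ActionSpace d) hv
  set G := isoGaussian (ActionSpace d) v
  set m := ∫ y, f y ∂G with hmdef
  have hc : Continuous f := continuous_iff_continuousAt.2 fun x => (hf x).continuousAt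
  have hfi : Integrable f G := Integrable.of_bound (C := K) hc.aestronglyMeasurable (ae_of_all _ hK)
  have hfl : Integrable (fun x => f x * Real.log (f x)) G := by
    refine Integrable.of_bound (C := K * (|Real.log ε| + |Real.log K|))
      (Real.continuous_mul_log.comp hc).aestronglyMeasurable (ae_of_all _ fun x => ?_)
    rw [norm_mul]
    exact mul_le_mul (hK x) (abs_log_le_of_mem_Icc hε (hεf x) ((le_abs_self _).trans (hK x)))
      (norm_nonneg _) ((norm_nonneg _).trans (hK 0))
  have hm : 0 < m := by
    refine hε.trans_le ?_
    calc ε = ∫ _, ε ∂G := by simp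
      _ ≤ m := integral_mono (integrable_const _) hfi hεf
  have hi1 : Integrable (fun x => f x * Real.log (f x) - f x * Real.log m) G :=
    hfl.sub (hfi.mul_const (Real.log m))
  have hi2 : Integrable (fun x => f x * Real.log (f x) - f x * Real.log m - f x) G :=
    hi1.sub hfi
  have hi : Integrable (fun x => entGap m (f x)) G := hi2.add (integrable_const m)
  rw [← ofReal_integral_eq_lintegral_ofReal hi
    (ae_of_all _ fun x => entGap_nonneg hm (hε.le.trans (hεf x)))]
  refine ENNReal.ofReal_le_ofReal (le_trans (le_of_eq ?_) h)
  calc ∫ x, entGap m (f x) ∂G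
      = ∫ x, f x * Real.log (f x) ∂G - (∫ x, f x * Real.log m ∂G) - (∫ x, f x ∂G)
          + ∫ _, m ∂G := by
        rw [← integral_sub hfl (hfi.mul_const _)]
        rw [← integral_sub hi1 hfi]
        exact integral_add hi2 (integrable_const m)
    _ = _ := by
        rw [integral_mul_const, integral_const, probReal_univ, ← hmdef, one_smul]
        ring

lemma gaussDensity_le (hv : 0 < v) (x : ActionSpace d) :
    gaussDensity v x ≤ 1 / ∫ y : ActionSpace d, gaussWeight v y := by
  unfold gaussDensity
  gcongr
  · exact (integral_gaussWeight_pos hv).le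
  · exact gaussWeight_le_one hv x

lemma MeasureTheory.Integrable.isoGaussian (hv : 0 < v) {u : ActionSpace d → ℝ}
    (hu : Integrable u) : Integrable u (isoGaussian (ActionSpace d) v) := by
  rw [integrable_isoGaussian_iff hv]
  refine hu.bdd_mul (c := 1 / ∫ y : ActionSpace d, gaussWeight v y)
    (continuous_gaussDensity v).aestronglyMeasurable (ae_of_all _ fun x => ?_)
  rw [Real.norm_of_nonneg (gaussDensity_pos hv x).le]
  exact gaussDensity_le hv x

lemma tendsto_integral_mollify_isoGaussian (hv : 0 < v) {u : ActionSpace d → ℝ}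
    (hu : Integrable u) :
    Tendsto (fun n => ∫ x, mollify n u x ∂(isoGaussian (ActionSpace d) v)) atTop
      (𝓝 (∫ x, u x ∂(isoGaussian (ActionSpace d) v))) := by
  simp_rw [integral_isoGaussian hv]
  refine tendsto_integral_mul_mollify hu (B := fun _ x => gaussDensity v x)
    (C := 1 / ∫ y : ActionSpace d, gaussWeight v y)
    (fun _ => (continuous_gaussDensity v).aestronglyMeasurable) (fun _ x => ?_)
    (ae_of_all _ fun x => tendsto_const_nhds)
  rw [Real.norm_of_nonneg (gaussDensity_pos hv x).le]
  exact gaussDensity_le hv x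

/-- The Fisher information density decreases under mollification, by convexity of
`(g, f) ↦ ‖g‖² / f`. -/
lemma norm_sq_mollify_div_le {f : ActionSpace d → ℝ} {g : ActionSpace d → ActionSpace d}
    (hf : LocallyIntegrable f) (hg : LocallyIntegrable g)
    (hq : LocallyIntegrable fun x => ‖g x‖ ^ 2 / f x) (hf0 : ∀ x, 0 ≤ f x)
    (hgf : ∀ x, f x = 0 → g x = 0) (n : ℕ) {δ : ℝ} (hδ : 0 < δ) (x : ActionSpace d) :
    ‖mollify n g x‖ ^ 2 / (mollify n f x + δ) ≤ mollify n (fun x => ‖g x‖ ^ 2 / f x) x := by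
  have hP : 0 < mollify n f x + δ := by linarith [mollify_nonneg n hf0 x]
  set k := (mollify n f x + δ)⁻¹ • mollify n g x with hk
  have hif := (integrable_mollify_integrand n hf x).const_mul (‖k‖ ^ 2)
  have hig : Integrable fun y => 2 * (inner ℝ k (mollifier d n (x - y) • g y) : ℝ) :=
    ((integrable_mollify_integrand n hg x).const_inner k).const_mul 2
  have h1 : ‖mollify n g x‖ ^ 2 / (mollify n f x + δ) =
      2 * inner ℝ k (mollify n g x) - ‖k‖ ^ 2 * (mollify n f x + δ) := by
    rw [hk, inner_smul_left, real_inner_self_eq_norm_sq, norm_smul, norm_inv, Real.norm_eq_abs,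
      abs_of_pos hP, conj_trivial]
    field_simp
    ring
  have h2 : 2 * inner ℝ k (mollify n g x) - ‖k‖ ^ 2 * mollify n f x =
      ∫ y, (2 * inner ℝ k (mollifier d n (x - y) • g y) -
        ‖k‖ ^ 2 * (mollifier d n (x - y) • f y)) := by
    rw [integral_sub hig hif, integral_const_mul, integral_const_mul,
      integral_inner (integrable_mollify_integrand n hg x), mollify_apply, mollify_apply]
  have h3 : 0 ≤ ‖k‖ ^ 2 * δ := by positivity
  calc ‖mollify n g x‖ ^ 2 / (mollify n f x + δ)
      ≤ 2 * inner ℝ k (mollify n g x) - ‖k‖ ^ 2 * mollify n f x := by rw [h1]; linarith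
    _ ≤ _ := by
        rw [h2, mollify_apply]
        refine integral_mono (hig.sub hif) (integrable_mollify_integrand n hq x) fun y => ?_
        simp only [inner_smul_right, smul_eq_mul]
        have hρ := mollifier_nonneg n (x - y)
        have hy : 2 * inner ℝ k (g y) - ‖k‖ ^ 2 * f y ≤ ‖g y‖ ^ 2 / f y := by
          rcases (hf0 y).eq_or_lt with h0 | h0
          · rw [hgf y h0.symm, ← h0]; simp
          · rw [le_div_iff₀ h0]
            have := real_inner_le_norm k (g y)
            nlinarith [sq_nonneg (‖k‖ * f y - ‖g y‖)]
        calc _ = mollifier d n (x - y) * (2 * inner ℝ k (g y) - ‖k‖ ^ 2 * f y) := by ring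
          _ ≤ _ := mul_le_mul_of_nonneg_left hy hρ

/-- The Gaussian logarithmic Sobolev inequality when all the data are Lebesgue integrable: apply
the smooth inequality to mollifications plus a small constant. -/
lemma lintegral_entGap_le_of_integrable (hv : 0 < v) {f : ActionSpace d → ℝ}
    {g : ActionSpace d → ActionSpace d} (h : HasWeakGradient f g) (hf0 : ∀ x, 0 ≤ f x)
    (hgf : ∀ x, f x = 0 → g x = 0) (hf : Integrable f) (hg : Integrable g)
    (hq : Integrable fun x => ‖g x‖ ^ 2 / f x)
    (hm : 0 < ∫ x, f x ∂(isoGaussian (ActionSpace d) v)) :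
    ∫⁻ x, ENNReal.ofReal (entGap (∫ y, f y ∂(isoGaussian (ActionSpace d) v)) (f x))
        ∂(isoGaussian (ActionSpace d) v) ≤
      ENNReal.ofReal (v / 2 * ∫ x, ‖g x‖ ^ 2 / f x ∂(isoGaussian (ActionSpace d) v)) := by
  have := isProbabilityMeasure_isoGaussian (E := ActionSpace d) hv
  have hδ0 := tendsto_one_div_add_atTop_nhds_zero_nat (𝕜 := ℝ)
  have hδ : ∀ n : ℕ, 0 < 1 / ((n : ℝ) + 1) := fun n => by positivity
  have hmf := fun n => (integrable_mollify n hf).isoGaussian hv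
  refine lintegral_entGap_le_of_tendsto
    (F := fun n x => mollify n f x + 1 / ((n : ℝ) + 1))
    (M := fun n => ∫ x, (mollify n f x + 1 / ((n : ℝ) + 1)) ∂(isoGaussian (ActionSpace d) v))
    (C := fun n => v / 2 * ∫ x, mollify n (fun x => ‖g x‖ ^ 2 / f x) x
      ∂(isoGaussian (ActionSpace d) v))
    (fun n => ((continuous_mollify n h.1).add continuous_const).aemeasurable) ?_ ?_ hm
    ((tendsto_integral_mollify_isoGaussian hv hq).const_mul _) (Eventually.of_forall fun n => ?_)
  · filter_upwards [(isoGaussian_absolutelyContinuous v).ae_le (tendsto_mollify_ae h.1)] with x hx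
    simpa using hx.add hδ0
  · have h1 := (tendsto_integral_mollify_isoGaussian hv hf).add hδ0
    rw [add_zero] at h1
    refine h1.congr fun n => ?_
    rw [integral_add (hmf n) (integrable_const _)]
    simp
  · obtain ⟨K, hK⟩ := exists_norm_mollify_le n hf
    obtain ⟨L, hL⟩ := exists_norm_mollify_le n hg
    have hpos : ∀ x, 1 / ((n : ℝ) + 1) ≤ mollify n f x + 1 / ((n : ℝ) + 1) := fun x => by
      linarith [mollify_nonneg n hf0 x]
    refine (lintegral_entGap_le_of_smooth hv (f := fun x => mollify n f x + 1 / ((n : ℝ) + 1))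
      (g := mollify n g) (fun x => (h.hasFDerivAt_mollify n x).add_const _)
      (continuous_mollify n h.2.1) (hδ n) hpos
      (K := K + 1 / ((n : ℝ) + 1)) (fun x => ?_) hL).trans ?_
    · refine (norm_add_le _ _).trans (add_le_add (hK x) ?_)
      rw [Real.norm_of_nonneg (hδ n).le]
    · refine ENNReal.ofReal_le_ofReal (mul_le_mul_of_nonneg_left ?_ (by positivity))
      refine integral_mono_of_nonneg
        (ae_of_all _ fun x => div_nonneg (sq_nonneg _) ((hδ n).le.trans (hpos x)))
        ((integrable_mollify n hq).isoGaussian hv) (ae_of_all _ fun x => ?_)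
      exact norm_sq_mollify_div_le h.1 h.2.1 hq.locallyIntegrable hf0 hgf n (hδ n) x

lemma locallyIntegrable_of_integrable_isoGaussian (hv : 0 < v) {u : ActionSpace d → ℝ}
    (hu : Integrable u (isoGaussian (ActionSpace d) v)) : LocallyIntegrable u := by
  rw [integrable_isoGaussian_iff hv] at hu
  have hc : Continuous fun x : ActionSpace d => (gaussDensity v x)⁻¹ :=
    (continuous_gaussDensity v).inv₀ fun x => (gaussDensity_pos hv x).ne'
  have := continuous_smul_locallyIntegrable hu.locallyIntegrable hc
  refine this.congr (ae_of_all _ fun x => ?_)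
  have := (gaussDensity_pos hv x).ne'
  simp only [smul_eq_mul]
  field_simp

/-- The elementary estimate behind the localization of the Fisher information to a ball. -/
lemma norm_sq_cutoff_div_le {f χ : ℝ} {g e : ActionSpace d} (hf : 0 ≤ f) {δ : ℝ} (hδ : 0 < δ) :
    ‖χ • (χ • g + f • e) + (χ * f) • e‖ ^ 2 / (χ * (χ * f)) ≤
      (1 + δ) * (χ ^ 2 * (‖g‖ ^ 2 / f)) + (1 + 1 / δ) * (4 * (‖e‖ ^ 2 * f)) := by
  have hrhs : 0 ≤ (1 + δ) * (χ ^ 2 * (‖g‖ ^ 2 / f)) + (1 + 1 / δ) * (4 * (‖e‖ ^ 2 * f)) := by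
    positivity
  rcases hf.eq_or_lt with rfl | hf
  · simp
  rcases eq_or_ne χ 0 with rfl | hχ
  · simp only [zero_mul, div_zero]; exact hrhs
  have h1 : χ • (χ • g + f • e) + (χ * f) • e = χ • (χ • g + (2 * f) • e) := by module
  have hχ2 : 0 < χ ^ 2 := by positivity
  rw [h1, norm_smul, mul_pow, Real.norm_eq_abs, sq_abs, ← mul_assoc, ← sq,
    mul_div_mul_left _ _ hχ2.ne', div_le_iff₀ hf]
  have h2 : ‖χ • g + (2 * f) • e‖ ≤ |χ| * ‖g‖ + 2 * f * ‖e‖ := by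
    refine (norm_add_le _ _).trans_eq ?_
    rw [norm_smul, norm_smul, Real.norm_eq_abs, Real.norm_of_nonneg (by positivity)]
  have h3 : ‖χ • g + (2 * f) • e‖ ^ 2 ≤ (|χ| * ‖g‖ + 2 * f * ‖e‖) ^ 2 :=
    pow_le_pow_left₀ (norm_nonneg _) h2 2
  have h4 : ((1 + δ) * (χ ^ 2 * (‖g‖ ^ 2 / f)) + (1 + 1 / δ) * (4 * (‖e‖ ^ 2 * f))) * f =
      (1 + δ) * (|χ| * ‖g‖) ^ 2 + (1 + 1 / δ) * (2 * f * ‖e‖) ^ 2 := by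
    rw [mul_pow |χ|, sq_abs]
    field_simp
    ring
  rw [h4]
  refine h3.trans ?_
  set a := |χ| * ‖g‖
  set b := 2 * f * ‖e‖
  have h5 : (1 + δ) * a ^ 2 + (1 + 1 / δ) * b ^ 2 - (a + b) ^ 2 = (δ * a - b) ^ 2 / δ := by
    field_simp
    ring
  have h6 : 0 ≤ (δ * a - b) ^ 2 / δ := by positivity
  linarith

/-- The Fisher information density of `χ² f` is Lebesgue integrable for a smooth compactly supported
cutoff `χ`, as soon as `f` and its own Fisher information density are locally integrable. -/
lemma integrable_norm_sq_cutoff_div {f χ : ActionSpace d → ℝ} {g e : ActionSpace d → ActionSpace d}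
    (hf0 : ∀ x, 0 ≤ f x) (hf : LocallyIntegrable f) (hg : LocallyIntegrable g)
    (hq : LocallyIntegrable fun x => ‖g x‖ ^ 2 / f x) (hχ : Continuous χ)
    (hχc : HasCompactSupport χ) (he : Continuous e) (hec : HasCompactSupport e) :
    Integrable fun x => ‖χ x • (χ x • g x + f x • e x) + (χ x * f x) • e x‖ ^ 2 /
      (χ x * (χ x * f x)) := by
  have hχ2c : HasCompactSupport fun x => χ x ^ 2 := by
    simp_rw [sq]; exact hχc.mul_left
  have he2c : HasCompactSupport fun x => ‖e x‖ ^ 2 := by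
    simp_rw [sq]; exact hec.norm.mul_left
  have i1 : Integrable fun x => χ x ^ 2 * (‖g x‖ ^ 2 / f x) :=
    hq.integrable_smul_left_of_hasCompactSupport (hχ.pow 2) hχ2c
  have i2 : Integrable fun x => ‖e x‖ ^ 2 * f x :=
    hf.integrable_smul_left_of_hasCompactSupport (he.norm.pow 2) he2c
  have hfm := hf.aestronglyMeasurable
  have hgm := hg.aestronglyMeasurable
  have hχm : AEStronglyMeasurable χ volume := hχ.aestronglyMeasurable
  have hem : AEStronglyMeasurable e volume := he.aestronglyMeasurable
  have hnum : AEStronglyMeasurable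
      (fun x => χ x • (χ x • g x + f x • e x) + (χ x * f x) • e x) volume :=
    (hχm.smul ((hχm.smul hgm).add (hfm.smul hem))).add ((hχm.mul hfm).smul hem)
  have hden : AEStronglyMeasurable (fun x => χ x * (χ x * f x)) volume := hχm.mul (hχm.mul hfm)
  refine ((i1.const_mul (1 + 1)).add ((i2.const_mul 4).const_mul (1 + 1 / 1))).mono'
    ((hnum.norm.aemeasurable.pow_const 2).div hden.aemeasurable).aestronglyMeasurable
    (ae_of_all _ fun x => ?_)
  have h0 : 0 ≤ χ x * (χ x * f x) := by
    rw [← mul_assoc]; exact mul_nonneg (mul_self_nonneg _) (hf0 x)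
  rw [Real.norm_of_nonneg (div_nonneg (sq_nonneg _) h0)]
  exact norm_sq_cutoff_div_le (hf0 x) one_pos

/-- The localized inequality: passing from `f` to `χ² f` costs an additional Fisher information of
the order of `‖∇χ‖² ∫ f`. -/
lemma lintegral_entGap_cutoff_le (hv : 0 < v) {f χ : ActionSpace d → ℝ}
    {g : ActionSpace d → ActionSpace d} (h : HasWeakGradient f g) (hf0 : ∀ x, 0 ≤ f x)
    (hgf : ∀ x, f x = 0 → g x = 0) (hf : Integrable f (isoGaussian (ActionSpace d) v))
    (hq : Integrable (fun x => ‖g x‖ ^ 2 / f x) (isoGaussian (ActionSpace d) v))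
    (hχ : ContDiff ℝ ((⊤ : ℕ∞) : WithTop ℕ∞) χ) (hχc : HasCompactSupport χ)
    (hχ0 : ∀ x, 0 ≤ χ x) (hχ1 : ∀ x, χ x ≤ 1) {C δ : ℝ} (hC : ∀ x, ‖gradient χ x‖ ≤ C)
    (hδ : 0 < δ) (hm : 0 < ∫ x, χ x * (χ x * f x) ∂(isoGaussian (ActionSpace d) v)) :
    ∫⁻ x, ENNReal.ofReal (entGap (∫ y, χ y * (χ y * f y) ∂(isoGaussian (ActionSpace d) v))
        (χ x * (χ x * f x))) ∂(isoGaussian (ActionSpace d) v) ≤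
      ENNReal.ofReal (v / 2 * ((1 + δ) * (∫ x, ‖g x‖ ^ 2 / f x ∂(isoGaussian (ActionSpace d) v)) +
        (1 + 1 / δ) * (4 * (C ^ 2 * ∫ x, f x ∂(isoGaussian (ActionSpace d) v))))) := by
  have he : Continuous (gradient χ) :=
    (InnerProductSpace.toDual ℝ (ActionSpace d)).symm.continuous.comp
      (hχ.continuous_fderiv (by simp))
  have hec : HasCompactSupport (gradient χ) := (hχc.fderiv ℝ).comp_left (map_zero _)
  have hw1 := h.smooth_mul hχ
  have hw2 := hw1.smooth_mul hχ
  have hF0 : ∀ x, 0 ≤ χ x * (χ x * f x) := fun x =>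
    mul_nonneg (hχ0 x) (mul_nonneg (hχ0 x) (hf0 x))
  have hΓ0 : ∀ x, χ x * (χ x * f x) = 0 →
      χ x • (χ x • g x + f x • gradient χ x) + (χ x * f x) • gradient χ x = 0 := fun x hx => by
    simp only [mul_eq_zero] at hx
    rcases hx with hx | hx | hx
    · simp [hx]
    · simp [hx]
    · simp [hx, hgf x hx]
  have hFi : Integrable fun x => χ x * (χ x * f x) :=
    hw1.1.integrable_smul_left_of_hasCompactSupport hχ.continuous hχc
  have hΓi : Integrable fun x =>
      χ x • (χ x • g x + f x • gradient χ x) + (χ x * f x) • gradient χ x :=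
    (hw1.2.1.integrable_smul_left_of_hasCompactSupport hχ.continuous hχc).add
      (hw1.1.integrable_smul_right_of_hasCompactSupport he hec)
  have hqi := integrable_norm_sq_cutoff_div hf0 h.1 h.2.1
    (locallyIntegrable_of_integrable_isoGaussian hv hq) hχ.continuous hχc he hec
  refine (lintegral_entGap_le_of_integrable hv hw2 hF0 hΓ0 hFi hΓi hqi hm).trans ?_
  refine ENNReal.ofReal_le_ofReal (mul_le_mul_of_nonneg_left ?_ (by positivity))
  have j1 := hq.const_mul (1 + δ)
  have j2 := ((hf.const_mul (C ^ 2)).const_mul 4).const_mul (1 + 1 / δ)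
  rw [← integral_const_mul, ← integral_const_mul, ← integral_const_mul, ← integral_const_mul,
    ← integral_add j1 j2]
  refine integral_mono_of_nonneg (ae_of_all _ fun x => div_nonneg (sq_nonneg _) (hF0 x))
    (j1.add j2) (ae_of_all _ fun x => ?_)
  refine (norm_sq_cutoff_div_le (hf0 x) hδ).trans (add_le_add ?_ ?_)
  · refine mul_le_mul_of_nonneg_left ?_ (by positivity)
    refine mul_le_of_le_one_left (div_nonneg (sq_nonneg _) (hf0 x)) ?_
    exact pow_le_one₀ (hχ0 x) (hχ1 x)
  · have h1 := pow_le_pow_left₀ (norm_nonneg _) (hC x) 2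
    have h2 := hf0 x
    gcongr

/-- The Gaussian logarithmic Sobolev inequality for weakly differentiable densities. -/
theorem gaussian_logSobolev (hv : 0 < v) {f : ActionSpace d → ℝ}
    {g : ActionSpace d → ActionSpace d} (h : HasWeakGradient f g) (hf0 : ∀ x, 0 ≤ f x)
    (hf : Integrable f (isoGaussian (ActionSpace d) v))
    (hq : Integrable (fun x => ‖g x‖ ^ 2 / f x) (isoGaussian (ActionSpace d) v))
    (hm : 0 < ∫ x, f x ∂(isoGaussian (ActionSpace d) v)) :
    ∫⁻ x, ENNReal.ofReal (entGap (∫ y, f y ∂(isoGaussian (ActionSpace d) v)) (f x))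
        ∂(isoGaussian (ActionSpace d) v) ≤
      ENNReal.ofReal (v / 2 * ∫ x, ‖g x‖ ^ 2 / f x ∂(isoGaussian (ActionSpace d) v)) := by
  classical
  -- the gradient may be assumed to vanish everywhere on the zero set of `f`
  wlog hgf : ∀ x, f x = 0 → g x = 0 generalizing g
  · have hg' : g =ᵐ[volume] fun x => if f x = 0 then 0 else g x := by
      filter_upwards [h.ae_eq_zero hf0] with x hx
      split_ifs with h0
      · exact hx h0
      · rfl
    have hqq : ∀ x, ‖(if f x = 0 then 0 else g x)‖ ^ 2 / f x = ‖g x‖ ^ 2 / f x := fun x => by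
      split_ifs with h0
      · simp [h0]
      · rfl
    have := this (h.congr_ae hg') (by simpa only [hqq] using hq) fun x hx => by simp [hx]
    simpa only [hqq] using this
  obtain ⟨C, hC⟩ := exists_norm_gradient_cutoff_le d
  have hFm : ∀ n, AEStronglyMeasurable (fun x => cutoff d n x * (cutoff d n x * f x))
      (isoGaussian (ActionSpace d) v) := fun n => by
    have := (contDiff_cutoff (d := d) n).continuous
    exact this.aestronglyMeasurable.mul (this.aestronglyMeasurable.mul hf.aestronglyMeasurable)
  have hFlim : ∀ x, Tendsto (fun n => cutoff d n x * (cutoff d n x * f x)) atTop (𝓝 (f x)) :=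
    fun x => by simpa using (tendsto_cutoff x).mul ((tendsto_cutoff x).mul_const (f x))
  have hM : Tendsto (fun n => ∫ x, cutoff d n x * (cutoff d n x * f x)
      ∂(isoGaussian (ActionSpace d) v)) atTop (𝓝 (∫ x, f x ∂(isoGaussian (ActionSpace d) v))) := by
    refine tendsto_integral_of_dominated_convergence f hFm hf
      (fun n => ae_of_all _ fun x => ?_) (ae_of_all _ hFlim)
    have h1 := cutoff_nonneg n x
    have h2 := cutoff_le_one n x
    have h3 := mul_nonneg h1 (hf0 x)
    rw [Real.norm_of_nonneg (mul_nonneg h1 h3)]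
    exact (mul_le_of_le_one_left h3 h2).trans (mul_le_of_le_one_left (hf0 x) h2)
  have hε0 := tendsto_one_div_add_atTop_nhds_zero_nat (𝕜 := ℝ)
  -- with `δ = 1 / (n + 1)` and `‖∇χ‖ ≤ C / (n + 1)` both error terms vanish in the limit
  refine lintegral_entGap_le_of_tendsto
    (C := fun n : ℕ => v / 2 * ((1 + 1 / ((n : ℝ) + 1)) *
      (∫ x, ‖g x‖ ^ 2 / f x ∂(isoGaussian (ActionSpace d) v)) +
      (1 + 1 / (1 / ((n : ℝ) + 1))) * (4 * ((C / ((n : ℝ) + 1)) ^ 2 *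
        ∫ x, f x ∂(isoGaussian (ActionSpace d) v)))))
    (fun n => (hFm n).aemeasurable) (ae_of_all _ hFlim) hM hm ?_ ?_
  · set I := ∫ x, ‖g x‖ ^ 2 / f x ∂(isoGaussian (ActionSpace d) v)
    set m := ∫ x, f x ∂(isoGaussian (ActionSpace d) v)
    have h1 : Tendsto (fun n : ℕ => v / 2 * ((1 + 1 / ((n : ℝ) + 1)) * I +
        (1 / ((n : ℝ) + 1) + 1) * (1 / ((n : ℝ) + 1)) * (4 * (C ^ 2 * m)))) atTop
        (𝓝 (v / 2 * ((1 + 0) * I + (0 + 1) * 0 * (4 * (C ^ 2 * m))))) :=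
      (((hε0.const_add 1).mul_const I).add
        (((hε0.add_const 1).mul hε0).mul_const (4 * (C ^ 2 * m)))).const_mul (v / 2)
    have h2 : v / 2 * ((1 + 0) * I + (0 + 1) * 0 * (4 * (C ^ 2 * m))) = v / 2 * I := by ring
    rw [h2] at h1
    refine h1.congr fun n => ?_
    field_simp
  · filter_upwards [hM.eventually (lt_mem_nhds hm)] with n hn
    exact lintegral_entGap_cutoff_le hv h hf0 hgf hf hq (contDiff_cutoff n)
      (hasCompactSupport_cutoff n) (cutoff_nonneg n) (cutoff_le_one n) (hC n)
      (by positivity) hn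

end LogSobolev

/-! ### Bounded perturbations of the Gaussian -/

section Perturbation

variable {d : ℕ} {v : ℝ}

/-- The relative entropy is at most the integral of the Bregman divergence from any constant `m`,
not only from the mean of the density, so that entropies for comparable reference measures compare. -/
lemma klDiv_le_lintegral_entGap {α : Type*} [MeasurableSpace α] {μ ν : Measure α}
    [IsProbabilityMeasure μ] [IsProbabilityMeasure ν] (hμν : μ ≪ ν) {m : ℝ} (hm : 0 < m) :
    klDiv μ ν ≤ ∫⁻ x, ENNReal.ofReal (entGap m (μ.rnDeriv ν x).toReal) ∂ν := by
  rw [klDiv_eq_lintegral_klFun_of_ac hμν]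
  set f : α → ℝ := fun x => (μ.rnDeriv ν x).toReal with hf
  have hf0 : ∀ x, 0 ≤ f x := fun x => ENNReal.toReal_nonneg
  have hfm : Measurable f := (Measure.measurable_rnDeriv μ ν).ennreal_toReal
  have hfi : Integrable f ν := Measure.integrable_toReal_rnDeriv
  have hf1 : ∫ x, f x ∂ν = 1 := by
    rw [hf, Measure.integral_toReal_rnDeriv hμν, probReal_univ]
  by_cases htop : ∫⁻ x, ENNReal.ofReal (entGap m (f x)) ∂ν = ∞
  · rw [htop]; exact le_top
  have hei : Integrable (fun x => entGap m (f x)) ν :=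
    (lintegral_ofReal_ne_top_iff_integrable
      ((measurable_entGap m).comp hfm).aestronglyMeasurable
      (ae_of_all _ fun x => entGap_nonneg hm (hf0 x))).1 htop
  have hli : Integrable (fun x => f x * Real.log m) ν := hfi.mul_const _
  have hkl : ∀ x, klFun (f x) = (entGap m (f x) + f x * Real.log m) + (1 - m) := fun x => by
    simp only [klFun, entGap]; ring
  have hei' : Integrable (fun x => entGap m (f x) + f x * Real.log m) ν := hei.add hli
  have hki : Integrable (fun x => klFun (f x)) ν := by
    simp_rw [hkl]
    exact hei'.add (integrable_const _)
  rw [← ofReal_integral_eq_lintegral_ofReal hki (ae_of_all _ fun x => klFun_nonneg (hf0 x)),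
    ← ofReal_integral_eq_lintegral_ofReal hei (ae_of_all _ fun x => entGap_nonneg hm (hf0 x))]
  refine ENNReal.ofReal_le_ofReal ?_
  simp_rw [hkl]
  rw [integral_add hei' (integrable_const _), integral_add hei hli, integral_mul_const, hf1,
    integral_const, probReal_univ, one_smul, one_mul]
  linarith [Real.log_le_sub_one_of_pos hm]

/-- The Holley–Stroock perturbation principle around the Gaussian: a probability density between
`a` and `b` times the Gaussian weight satisfies a logarithmic Sobolev inequality whose constant is
the Gaussian one, `1 / v`, multiplied by `a / b`. -/
theorem satisfiesLSI_of_le_of_le (hv : 0 < v) {p : ActionSpace d → ℝ} (hp : Measurable p)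
    {a b : ℝ} (ha : 0 < a) (hap : ∀ x, a * gaussWeight v x ≤ p x)
    (hpb : ∀ x, p x ≤ b * gaussWeight v x)
    [IsProbabilityMeasure (volume.withDensity fun x => ENNReal.ofReal (p x))] :
    SatisfiesLSI (volume.withDensity fun x => ENNReal.ofReal (p x)) (a / (b * v)) := by
  set ν := volume.withDensity fun x => ENNReal.ofReal (p x) with hν
  set G := isoGaussian (ActionSpace d) v with hG
  set Z := ∫ y : ActionSpace d, gaussWeight v y with hZdef
  have hZ : 0 < Z := integral_gaussWeight_pos hv
  have hb : 0 < b := by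
    have h1 := (hap 0).trans (hpb 0)
    exact ha.trans_le (le_of_mul_le_mul_right h1 (gaussWeight_pos v 0))
  have hpm : Measurable fun x => ENNReal.ofReal (p x) := hp.ennreal_ofReal
  have hGm := measurable_ofReal_gaussDensity (E := ActionSpace d) v
  have hνG : ν ≤ ENNReal.ofReal (b * Z) • G := by
    rw [hν, hG, isoGaussian, ← withDensity_smul _ hGm]
    refine withDensity_mono (ae_of_all _ fun x => ?_)
    rw [Pi.smul_apply, smul_eq_mul, ← ENNReal.ofReal_mul (by positivity)]
    refine ENNReal.ofReal_le_ofReal ((hpb x).trans_eq ?_)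
    simp only [gaussDensity]
    rw [← hZdef]
    field_simp
  have hGν : G ≤ ENNReal.ofReal (1 / (a * Z)) • ν := by
    rw [hν, hG, isoGaussian, ← withDensity_smul _ hpm]
    refine withDensity_mono (ae_of_all _ fun x => ?_)
    rw [Pi.smul_apply, smul_eq_mul, ← ENNReal.ofReal_mul (by positivity)]
    refine ENNReal.ofReal_le_ofReal ?_
    simp only [gaussDensity]
    rw [← hZdef, div_mul_eq_mul_div, one_mul, div_le_div_iff₀ hZ (by positivity)]
    calc gaussWeight v x * (a * Z) = a * gaussWeight v x * Z := by ring
      _ ≤ p x * Z := by gcongr; exact hap x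
  have hνvol : ν ≪ volume := withDensity_absolutelyContinuous _ _
  have hνacG : ν ≪ G :=
    (Measure.absolutelyContinuous_of_le hνG).trans Measure.smul_absolutelyContinuous
  refine ⟨by positivity, fun μ hμ hμν => le_iInf₂ fun g hg => ?_⟩
  set f : ActionSpace d → ℝ := fun x => (μ.rnDeriv ν x).toReal with hf
  have hf0 : ∀ x, 0 ≤ f x := fun x => ENNReal.toReal_nonneg
  have hfm : Measurable f := (Measure.measurable_rnDeriv μ ν).ennreal_toReal
  have hgm : AEMeasurable g ν := hg.2.1.aestronglyMeasurable.aemeasurable.mono_ac hνvol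
  -- the Fisher information in terms of the density
  have hI : ∫⁻ x, ‖(f x)⁻¹ • g x‖ₑ ^ 2 ∂μ = ∫⁻ x, ENNReal.ofReal (‖g x‖ ^ 2 / f x) ∂ν := by
    have hem : AEMeasurable (fun x => ‖(f x)⁻¹ • g x‖ₑ ^ 2) ν :=
      (hfm.aemeasurable.inv.smul hgm).enorm.pow_const 2
    rw [← lintegral_rnDeriv_mul hμν hem]
    refine lintegral_congr_ae ?_
    filter_upwards [Measure.rnDeriv_lt_top μ ν] with x hx
    have h1 : μ.rnDeriv ν x = ENNReal.ofReal (f x) := (ENNReal.ofReal_toReal hx.ne).symm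
    rw [h1, ← ofReal_norm, ← ENNReal.ofReal_pow (norm_nonneg _),
      ← ENNReal.ofReal_mul (hf0 x)]
    congr 1
    rw [norm_smul, norm_inv, Real.norm_of_nonneg (hf0 x)]
    rcases (hf0 x).eq_or_lt with h0 | h0
    · rw [← h0]; simp
    · field_simp
  rw [hI]
  by_cases htop : ∫⁻ x, ENNReal.ofReal (‖g x‖ ^ 2 / f x) ∂ν = ∞
  · rw [htop]; exact le_top
  have hq0 : ∀ x, 0 ≤ ‖g x‖ ^ 2 / f x := fun x => div_nonneg (sq_nonneg _) (hf0 x)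
  have hqν : Integrable (fun x => ‖g x‖ ^ 2 / f x) ν :=
    (lintegral_ofReal_ne_top_iff_integrable
      ((hgm.norm.pow_const 2).div hfm.aemeasurable).aestronglyMeasurable
      (ae_of_all _ hq0)).1 htop
  have hqG : Integrable (fun x => ‖g x‖ ^ 2 / f x) G :=
    (hqν.smul_measure ENNReal.ofReal_ne_top).mono_measure hGν
  have hfν : Integrable f ν := Measure.integrable_toReal_rnDeriv
  have hfG : Integrable f G := (hfν.smul_measure ENNReal.ofReal_ne_top).mono_measure hGν
  have hm : 0 < ∫ x, f x ∂G := by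
    refine (integral_nonneg hf0).lt_of_ne fun h0 => ?_
    have h1 : f =ᵐ[G] 0 := (integral_eq_zero_iff_of_nonneg hf0 hfG).1 h0.symm
    have h2 : ∫ x, f x ∂ν = 0 := integral_eq_zero_of_ae (hνacG.ae_le h1)
    rw [hf, Measure.integral_toReal_rnDeriv hμν, probReal_univ] at h2
    exact one_ne_zero h2
  have hlsi := gaussian_logSobolev hv hg hf0 hfG hqG hm
  rw [← hG] at hlsi
  calc ENNReal.ofReal (2 * (a / (b * v))) * klDiv μ ν
      ≤ ENNReal.ofReal (2 * (a / (b * v))) *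
          ∫⁻ x, ENNReal.ofReal (entGap (∫ y, f y ∂G) (f x)) ∂ν := by
        gcongr; exact klDiv_le_lintegral_entGap hμν hm
    _ ≤ ENNReal.ofReal (2 * (a / (b * v))) * (ENNReal.ofReal (b * Z) *
          ∫⁻ x, ENNReal.ofReal (entGap (∫ y, f y ∂G) (f x)) ∂G) := by
        gcongr
        refine (lintegral_mono' hνG le_rfl).trans_eq ?_
        rw [lintegral_smul_measure, smul_eq_mul]
    _ ≤ ENNReal.ofReal (2 * (a / (b * v))) * (ENNReal.ofReal (b * Z) *
          (ENNReal.ofReal (v / 2) * ∫⁻ x, ENNReal.ofReal (‖g x‖ ^ 2 / f x) ∂G)) := by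
        gcongr
        rw [← ofReal_integral_eq_lintegral_ofReal hqG (ae_of_all _ hq0),
          ← ENNReal.ofReal_mul (by positivity)]
        exact hlsi
    _ ≤ ENNReal.ofReal (2 * (a / (b * v))) * (ENNReal.ofReal (b * Z) *
          (ENNReal.ofReal (v / 2) * (ENNReal.ofReal (1 / (a * Z)) *
            ∫⁻ x, ENNReal.ofReal (‖g x‖ ^ 2 / f x) ∂ν))) := by
        gcongr
        refine (lintegral_mono' hGν le_rfl).trans_eq ?_
        rw [lintegral_smul_measure, smul_eq_mul]
    _ = ∫⁻ x, ENNReal.ofReal (‖g x‖ ^ 2 / f x) ∂ν := by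
        rw [← mul_assoc, ← mul_assoc, ← mul_assoc, ← ENNReal.ofReal_mul (by positivity),
          ← ENNReal.ofReal_mul (by positivity), ← ENNReal.ofReal_mul (by positivity)]
        have : 2 * (a / (b * v)) * (b * Z) * (v / 2) * (1 / (a * Z)) = 1 := by field_simp
        rw [this, ENNReal.ofReal_one, one_mul]

end Perturbation

/-! ### Measurability and bounds for the soft value and the Gibbs density -/

section SoftValue

namespace SoftMDP

variable {S : Type*} [MeasurableSpace S] {d : ℕ} (M : SoftMDP S d) (π : Policy S d)

lemma measurable_discountedReward (n : ℕ) : Measurable fun ω => M.discountedReward π ω n := by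
  unfold discountedReward regReward
  have h1 : Measurable fun ω : ℕ → S × ActionSpace d => M.r (ω n).1 (ω n).2 :=
    M.measurable_r.comp (measurable_pi_apply n)
  have h2 : Measurable fun ω : ℕ → S × ActionSpace d => π.dens (ω n).1 (ω n).2 :=
    π.measurable_dens.comp (measurable_pi_apply n)
  have h3 : Measurable fun ω : ℕ → S × ActionSpace d => ‖(ω n).2‖ :=
    (measurable_snd.comp (measurable_pi_apply n)).norm
  exact ((h1.sub ((h3.pow_const 2).const_mul _)).sub (h2.log.const_mul _)).const_mul _

lemma stronglyMeasurable_softValue : StronglyMeasurable (M.softValue π) :=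
  StronglyMeasurable.integral_kernel
    (Measurable.tsum fun n => M.measurable_discountedReward π n).stronglyMeasurable

lemma measurable_softQ (s : S) : Measurable (M.softQ π s) := by
  have hs : Measurable fun a : ActionSpace d => (s, a) := measurable_prodMk_left
  have h1 : Measurable fun a => M.r s a := M.measurable_r.comp hs
  have h2 : Measurable fun z => ∫ s', M.softValue π s' ∂(M.P z) :=
    (M.stronglyMeasurable_softValue π).integral_kernel.measurable
  unfold softQ regReward
  exact (h1.sub ((measurable_norm.pow_const 2).const_mul _)).add ((h2.comp hs).const_mul _)

variable {M π}

/-- The action value is the quadratic penalty up to a bounded term. -/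
lemma abs_softQ_add_le {Rmax Vmax : ℝ} (hR : ∀ s a, |M.r s a| ≤ Rmax)
    (hV : ∀ s, |M.softValue π s| ≤ Vmax) (s : S) (a : ActionSpace d) :
    |M.softQ π s a + M.β / 2 * ‖a‖ ^ 2| ≤ Rmax + M.γ * Vmax := by
  have h1 : |∫ s', M.softValue π s' ∂(M.P (s, a))| ≤ Vmax := by
    have := norm_integral_le_of_norm_le_const (μ := M.P (s, a))
      (f := M.softValue π) (ae_of_all _ hV)
    simpa using this
  have h2 : M.softQ π s a + M.β / 2 * ‖a‖ ^ 2 =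
      M.r s a + M.γ * ∫ s', M.softValue π s' ∂(M.P (s, a)) := by
    unfold softQ regReward; ring
  rw [h2]
  refine (abs_add_le _ _).trans (add_le_add (hR s a) ?_)
  rw [abs_mul, abs_of_pos M.γ_pos]
  exact mul_le_mul_of_nonneg_left h1 M.γ_pos.le

end SoftMDP

end SoftValue

/-! ### The uniform logarithmic Sobolev inequality -/

theorem mainTheorem5 {S : Type*} [MeasurableSpace S] {d : ℕ} (M : SoftMDP S d)
    (Rmax Vmax : ℝ) (hR : ∀ s a, |M.r s a| ≤ Rmax)
    (π : Policy S d) (hπ : M.HasSoftValue π) (hV : ∀ s, |M.softValue π s| ≤ Vmax) (s : S) :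
    (∀ a, 0 < M.gibbsDensity π s a) ∧
    IsProbabilityMeasure (M.gibbsMeasure π s) ∧
    SatisfiesLSI (M.gibbsMeasure π s)
      (M.β / M.τ * Real.exp (-(2 * (Rmax + M.γ * Vmax)) / M.τ)) := by
  have hτ := M.τ_pos
  have hβ := M.β_pos
  set C := (Rmax + M.γ * Vmax) / M.τ with hC
  -- the reference Gaussian has variance `τ / β`
  set v := M.τ / M.β with hv_def
  have hv : 0 < v := div_pos hτ hβ
  have hQm : Measurable fun a => Real.exp (M.softQ π s a / M.τ) :=
    ((M.measurable_softQ π s).div_const _).exp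
  have hsplit : ∀ a, Real.exp (M.softQ π s a / M.τ) =
      Real.exp ((M.softQ π s a + M.β / 2 * ‖a‖ ^ 2) / M.τ) * gaussWeight v a := fun a => by
    rw [gaussWeight, ← Real.exp_add]
    congr 1
    rw [hv_def]
    field_simp
    ring
  have hbd : ∀ a, |(M.softQ π s a + M.β / 2 * ‖a‖ ^ 2) / M.τ| ≤ C := fun a => by
    rw [abs_div, abs_of_pos hτ]
    exact div_le_div_of_nonneg_right (SoftMDP.abs_softQ_add_le hR hV s a) hτ.le
  have hlow : ∀ a, Real.exp (-C) * gaussWeight v a ≤ Real.exp (M.softQ π s a / M.τ) := fun a => by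
    rw [hsplit]
    exact mul_le_mul_of_nonneg_right (Real.exp_le_exp.2 (abs_le.1 (hbd a)).1)
      (gaussWeight_pos v a).le
  have hupp : ∀ a, Real.exp (M.softQ π s a / M.τ) ≤ Real.exp C * gaussWeight v a := fun a => by
    rw [hsplit]
    exact mul_le_mul_of_nonneg_right (Real.exp_le_exp.2 (abs_le.1 (hbd a)).2)
      (gaussWeight_pos v a).le
  have hint : Integrable fun a => Real.exp (M.softQ π s a / M.τ) :=
    ((integrable_gaussWeight hv).const_mul (Real.exp C)).mono' hQm.aestronglyMeasurable
      (ae_of_all _ fun a => by rw [Real.norm_of_nonneg (Real.exp_pos _).le]; exact hupp a)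
  have hZ : 0 < ∫ a, Real.exp (M.softQ π s a / M.τ) := integral_exp_pos hint
  set Z := ∫ a, Real.exp (M.softQ π s a / M.τ) with hZ_def
  have hpos : ∀ a, 0 < M.gibbsDensity π s a := fun a => div_pos (Real.exp_pos _) hZ
  have hpm : Measurable (M.gibbsDensity π s) := hQm.div_const _
  have hprob : IsProbabilityMeasure (M.gibbsMeasure π s) := by
    refine ⟨?_⟩
    have hpi : Integrable (M.gibbsDensity π s) := hint.div_const Z
    rw [SoftMDP.gibbsMeasure, withDensity_apply _ MeasurableSet.univ, Measure.restrict_univ,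
      ← ofReal_integral_eq_lintegral_ofReal hpi (ae_of_all _ fun a => (hpos a).le)]
    simp only [SoftMDP.gibbsDensity]
    rw [integral_div, ← hZ_def, div_self hZ.ne', ENNReal.ofReal_one]
  refine ⟨hpos, hprob, ?_⟩
  have hconst : M.β / M.τ * Real.exp (-(2 * (Rmax + M.γ * Vmax)) / M.τ) =
      Real.exp (-C) / Z / (Real.exp C / Z * v) := by
    have h1 : -(2 * (Rmax + M.γ * Vmax)) / M.τ = -C - C := by rw [hC]; ring
    rw [h1, Real.exp_sub, hv_def]
    field_simp
  rw [hconst]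
  have : IsProbabilityMeasure
      (volume.withDensity fun a => ENNReal.ofReal (M.gibbsDensity π s a)) := hprob
  refine satisfiesLSI_of_le_of_le hv hpm (by positivity) (fun a => ?_) fun a => ?_
  · rw [SoftMDP.gibbsDensity, div_mul_eq_mul_div]
    exact div_le_div_of_nonneg_right (hlow a) hZ.le
  · rw [SoftMDP.gibbsDensity, div_mul_eq_mul_div]
    exact div_le_div_of_nonneg_right (hupp a) hZ.le
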